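/- **Conventions.** For a completely regular Hausdorff space $Z$, let $C_b(Z)$ be the space of bounded continuous functions $Z\to\mathbb R$, let $\mathcal U(Z)$ be the algebra of subsets of $Z$ generated by the zero-sets $f^{-1}(0)$ ($f:Z\to\mathbb R$ continuous), and let $\mathcal B(Z)$ be the Borel $\sigma$-algebra. Let $\mathcal M^1(Z)$ be the set of finitely additive functions $\gamma:\mathcal U(Z)\to[0,\infty)$ with $\gamma(Z)=1$ that are regular: for all $A\in\mathcal U(Z)$ and $\varepsilon>0$ there is a zero-set $F\subseteq A$ with $\gamma(B)<\varepsilon$ for every $B\in\mathcal U(Z)$, $B\subseteq A\setminus F$. For $f\in C_b(Z)$ the integral $\int_Z f\,d\gamma$ is the supremum of $\sum_i a_i\gamma(A_i)$ over all step functions $\sum_i a_i\mathbf 1_{A_i}\le f$ with $(A_i)$ a finite partition of $Z$ into members of $\mathcal U(Z)$. Let $lsc_{bi}(Z)$ be the set of lower semicontinuous functions $g:Z\to\mathbb R\cup\{+\infty\}$ that are bounded from below and not identically $+\infty$; for $g\in lsc_{bi}(Z)$ and $\gamma\in\mathcal M^1(Z)$ put $\int_Z g\,d\gamma:=\sup\{\int_Z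 f\,d\gamma: f\in C_b(Z),\ f\le g\}$. A Borel probability measure $\gamma$ on $Z$ is Radon if for all $B\in\mathcal B(Z)$ and $\varepsilon>0$ there is a compact $K\subseteq B$ with $\gamma(B\setminus K)<\varepsilon$; its integrals are the usual ones. For Radon probability measures $\mu$ on $X$ and $\nu$ on $Y$, let $\Pi(\mu,\nu)$ be the set of Radon probability measures on $\mathcal B(X\times Y)$ with marginals $\mu$ and $\nu$, and let $$\Gamma(\mu,\nu)=\Bigl\{\gamma\in\mathcal M^1(X\times Y):\ \int_{X\times Y}\bigl(\varphi(x)+\psi(y)\bigr)\,d\gamma(x,y)=\int_X\varphi\,d\mu+\int_Y\psi\,d\nu\ \ \forall\varphi\in C_b(X),\ \psi\in C_b(Y)\Bigr\}.$$ For $c\in lsc_{bi}(X\times Y)$ consider $$(\mathrm{OP})\quad v(\mathrm{OP})=\inf_{\gamma\in\Gamma(\mu,\nu)}\int_{X\times Y} c\,d\gamma,\qquad (\mathrm{KP})\quad v(\mathrm{KP})=\inf_{\gamma\in\Pi(\mu,\nu)}\int_{X\times Y} c\,d\gamma .$$ **Theorem.** Let $X$ and $Y$ be perfectly normal Hausdorff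 spaces and let $\mu$, $\nu$ be Radon probability measures on $X$, $Y$. Then $\Gamma(\mu,\nu)=\Pi(\mu,\nu)$, in the sense that restriction of measures from $\mathcal B(X\times Y)$ to $\mathcal U(X\times Y)$ is a bijection from $\Pi(\mu,\nu)$ onto $\Gamma(\mu,\nu)$. Consequently (OP) and (KP) coincide for every $c\in lsc_{bi}(X\times Y)$: the integral of $c$ against each $\gamma\in\Pi(\mu,\nu)$ equals its integral against the restriction of $\gamma$ to $\mathcal U(X\times Y)$, and $v(\mathrm{OP})=v(\mathrm{KP})$. Moreover, if $c\in lsc_{bi}(X\times Y)$ and $v(\mathrm{KP})<+\infty$, then (KP) has a solution: there is $\gamma^*\in\Pi(\mu,\nu)$ with $\int_{X\times Y} c\,d\gamma^*=v(\mathrm{KP})$. -/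

import Mathlib

open MeasureTheory Set BoundedContinuousFunction

noncomputable section

namespace KantorovichCharge

universe u v

section Charges

variable (Z : Type u) [TopologicalSpace Z]

/-- The zero-sets of `Z`: the sets `f ⁻¹' {0}` with `f : Z → ℝ` continuous. -/
def zeroSets : Set (Set Z) := {A | ∃ f : C(Z, ℝ), A = f ⁻¹' {0}}

/-- The algebra `𝒰(Z)` of subsets of `Z` generated by the zero-sets. -/
def zeroAlgebra : Set (Set Z) := generateSetAlgebra (zeroSets Z)

theorem univ_mem_zeroAlgebra : (univ : Set Z) ∈ zeroAlgebra Z :=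
  isSetAlgebra_generateSetAlgebra.univ_mem

variable {Z}

/-- The space `ℳ(Z)`: real set functions on the algebra `𝒰(Z)` that are finitely additive,
uniformly bounded, and (inner) regular with respect to the zero-sets. -/
structure IsRegularCharge (m : zeroAlgebra Z → ℝ) : Prop where
  additive : ∀ A B C : zeroAlgebra Z, Disjoint (A : Set Z) (B : Set Z) →
    (C : Set Z) = (A : Set Z) ∪ (B : Set Z) → m C = m A + m B
  bounded : ∃ M : ℝ, ∀ A : zeroAlgebra Z, |m A| ≤ M
  regular : ∀ A : zeroAlgebra Z, ∀ ε : ℝ, 0 < ε → ∃ F ∈ zeroSets Z, F ⊆ (A : Set Z) ∧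
    ∀ B : zeroAlgebra Z, (B : Set Z) ⊆ (A : Set Z) \ F → |m B| < ε

variable (Z) in
/-- `ℳ¹(Z)`: the non-negative regular charges of total mass one. -/
def unitCharges : Set (zeroAlgebra Z → ℝ) :=
  {m | IsRegularCharge m ∧ (∀ A, 0 ≤ m A) ∧ m ⟨univ, univ_mem_zeroAlgebra Z⟩ = 1}

/-- The integrals `∑ aᵢ m(Aᵢ)` of the step functions `∑ aᵢ 1_{Aᵢ} ≤ f`, where `A₁, …, Aₙ` is a
finite partition of `Z` into members of `𝒰(Z)`. -/
def lowerSums (m : zeroAlgebra Z → ℝ) (f : Z →ᵇ ℝ) : Set ℝ :=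
  {r | ∃ (n : ℕ) (A : Fin n → zeroAlgebra Z) (a : Fin n → ℝ),
    Pairwise (fun i j => Disjoint (A i : Set Z) (A j : Set Z)) ∧
    (⋃ i, (A i : Set Z)) = univ ∧
    (∀ i, ∀ z ∈ (A i : Set Z), a i ≤ f z) ∧
    r = ∑ i, a i * m (A i)}

/-- The integral `∫ f dm` of a bounded continuous function against a non-negative charge `m`
on `𝒰(Z)`: the supremum of the integrals of the step functions below `f`. (A bounded continuous
function is a uniform limit of `𝒰(Z)`-step functions, so the supremum from below agrees with the
infimum from above and with the limit along any uniformly convergent sequence of step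
functions.) -/
def chargeIntegral (m : zeroAlgebra Z → ℝ) (f : Z →ᵇ ℝ) : ℝ := sSup (lowerSums m f)

variable (Z) in
/-- Proper, bounded from below, lower semicontinuous functions `Z → ℝ ∪ {+∞}`. -/
def lscBoundedBelow : Set (Z → EReal) :=
  {g | LowerSemicontinuous g ∧ (∃ b : ℝ, ∀ z, (b : EReal) ≤ g z) ∧ ∃ z, g z ≠ ⊤}

/-- The (lower) integral `∫ g dm = sup {∫ f dm : f ∈ C_b(Z), f ≤ g}` of a function bounded from
below against a non-negative charge. -/
def chargeLowerIntegral (m : zeroAlgebra Z → ℝ) (g : Z → EReal) : EReal :=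
  ⨆ (f : Z →ᵇ ℝ) (_ : ∀ z, ((f z : ℝ) : EReal) ≤ g z), ((chargeIntegral m f : ℝ) : EReal)

end Charges

section Measures

/-- The Borel measures on `Z`, that is, the measures on the `σ`-algebra generated by the topology.
It is needed for `Z = X × Y`, where the Borel `σ`-algebra can be larger than the product
`σ`-algebra. -/
abbrev BorelMeasure (Z : Type u) [TopologicalSpace Z] : Type u := @Measure Z (borel Z)

variable {Z : Type u} [TopologicalSpace Z]

/-- Radon probability measures: every Borel set is approximated in measure from inside by
compact sets. -/
def IsRadonProbability [MeasurableSpace Z] (γ : Measure Z) : Prop :=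
  IsProbabilityMeasure γ ∧
    ∀ B : Set Z, MeasurableSet B → ∀ ε : ENNReal, 0 < ε →
      ∃ K : Set Z, IsCompact K ∧ K ⊆ B ∧ γ (B \ K) < ε

/-- The usual integral `∫ g⁺ dγ - ∫ g⁻ dγ` of an extended real valued function. For `γ` finite and
`g` bounded from below the second term is finite. -/
def extIntegral [MeasurableSpace Z] (γ : Measure Z) (g : Z → EReal) : EReal :=
  ((∫⁻ z, (g z).toENNReal ∂γ : ENNReal) : EReal) -
    ((∫⁻ z, (-g z).toENNReal ∂γ : ENNReal) : EReal)

/-- The set function on `𝒰(Z)` that a Borel measure induces by restriction. -/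
def toCharge (γ : BorelMeasure Z) : zeroAlgebra Z → ℝ := fun A => (γ (A : Set Z)).toReal

end Measures

section Transport

variable {X : Type u} {Y : Type v} [TopologicalSpace X] [TopologicalSpace Y]
  [MeasurableSpace X] [MeasurableSpace Y]

/-- The function `(φ ⊕ ψ)(x, y) = φ x + ψ y`. -/
def oplus (φ : X →ᵇ ℝ) (ψ : Y →ᵇ ℝ) : (X × Y) →ᵇ ℝ :=
  φ.compContinuous ⟨Prod.fst, continuous_fst⟩ + ψ.compContinuous ⟨Prod.snd, continuous_snd⟩

/-- `Γ(μ, ν)`: the charges `γ ∈ ℳ¹(X × Y)` with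
`∫ φ ⊕ ψ dγ = ∫ φ dμ + ∫ ψ dν` for all bounded continuous `φ`, `ψ`. -/
def chargePlans (μ : Measure X) (ν : Measure Y) : Set (zeroAlgebra (X × Y) → ℝ) :=
  {γ | γ ∈ unitCharges (X × Y) ∧ ∀ (φ : X →ᵇ ℝ) (ψ : Y →ᵇ ℝ),
    chargeIntegral γ (oplus φ ψ) = (∫ x, φ x ∂μ) + ∫ y, ψ y ∂ν}

/-- `Π(μ, ν)`: the transport plans, i.e. the Radon probability measures on the Borel
`σ`-algebra of `X × Y` whose push-forwards under the projections are `μ` and `ν`. -/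
def transportPlans (μ : Measure X) (ν : Measure Y) : Set (BorelMeasure (X × Y)) :=
  {γ | @IsRadonProbability (X × Y) _ (borel (X × Y)) γ ∧
    @Measure.map (X × Y) X (borel (X × Y)) _ Prod.fst γ = μ ∧
    @Measure.map (X × Y) Y (borel (X × Y)) _ Prod.snd γ = ν}

/-- The cost `∫ c dγ` of a Borel measure on `X × Y`. -/
def planCost (c : X × Y → EReal) (γ : BorelMeasure (X × Y)) : EReal :=
  @extIntegral (X × Y) (borel (X × Y)) γ c

/-- The value of the problem (OP): minimize `∫ c dγ` over `γ ∈ Γ(μ, ν)`. -/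
def valueOP (μ : Measure X) (ν : Measure Y) (c : X × Y → EReal) : EReal :=
  ⨅ γ ∈ chargePlans μ ν, chargeLowerIntegral γ c

/-- The value of the problem (KP): minimize `∫ c dγ` over `γ ∈ Π(μ, ν)`. -/
def valueKP (μ : Measure X) (ν : Measure Y) (c : X × Y → EReal) : EReal :=
  ⨅ γ ∈ transportPlans μ ν, planCost c γ

end Transport

end KantorovichCharge

end

open MeasureTheory Set BoundedContinuousFunction

namespace KantorovichCharge

universe u v

/-! ### Integration of bounded continuous functions against charges. -/

section ChargeIntegral

variable {Z : Type u} [TopologicalSpace Z]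

/-! Both kinds of plan are compared with a third object: positive normalized linear functionals on
`C_b(X × Y)` with the prescribed marginals (`marginalMeans`). Charges and Radon measures define such
functionals by integration. A regular charge is determined by its functional because disjoint
zero-sets are separated by continuous functions (`unitCharges_ext`); a Radon measure on a Tychonoff
space is determined because compact sets are separated from closed ones
(`measure_ext_of_integral_eq`).

The decisive point is that Radon marginals force tightness: a function small on `K × L` is dominated
by a small constant plus some `(1 - φ) ⊕ (1 - ψ)`, whose value is read off from `μ` and `ν`
(`isTightMean_of_mem_marginalMeans`). A tight functional is represented on the Stone–Čech
compactification by a regular measure, which tightness concentrates on a σ-compact subset of the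
original space; pulling it back gives a Radon measure. Hence every charge in `Γ(μ, ν)` comes from a
plan.

For lower semicontinuous `c` the usual integral is the supremum of integrals of smaller bounded
continuous functions, so the costs agree. That supremum is lower semicontinuous for pointwise
convergence of functionals, and the functionals with given marginals form a compact set by
Tychonoff; a minimizer therefore exists. -/

theorem isSetAlgebra_zeroAlgebra : IsSetAlgebra (zeroAlgebra Z) :=
  isSetAlgebra_generateSetAlgebra

theorem preimage_zero_mem_zeroSets {f : Z → ℝ} (hf : Continuous f) : f ⁻¹' {0} ∈ zeroSets Z :=
  ⟨⟨f, hf⟩, rfl⟩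

theorem setOf_le_mem_zeroSets {f : Z → ℝ} (hf : Continuous f) (a : ℝ) :
    {z | a ≤ f z} ∈ zeroSets Z := by
  have h : {z | a ≤ f z} = (fun z => max (a - f z) 0) ⁻¹' {0} := by
    ext z; simp
  rw [h]
  exact preimage_zero_mem_zeroSets (by fun_prop)

theorem mem_zeroAlgebra_of_mem_zeroSets {F : Set Z} (hF : F ∈ zeroSets Z) : F ∈ zeroAlgebra Z :=
  self_subset_generateSetAlgebra hF

namespace IsRegularCharge

variable {m : zeroAlgebra Z → ℝ}

theorem apply_empty (hm : IsRegularCharge m) {A : zeroAlgebra Z} (hA : (A : Set Z) = ∅) :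
    m A = 0 := by
  have := hm.additive A A A (by simp [hA]) (by simp)
  linarith

open Classical in
/-- A finitely additive set function on `𝒰(Z)` as an additive content, extended by zero to all
subsets. -/
noncomputable def addContent (hm : IsRegularCharge m) : AddContent ℝ (zeroAlgebra Z) :=
  isSetAlgebra_zeroAlgebra.isSetRing.addContent_of_union
    (fun A => if h : A ∈ zeroAlgebra Z then m ⟨A, h⟩ else 0)
    (by
      simp only [dif_pos (isSetAlgebra_zeroAlgebra (Z := Z)).empty_mem]
      exact hm.apply_empty rfl)
    (fun {s t} hs ht hst => by
      simp only [dif_pos hs, dif_pos ht, dif_pos (isSetAlgebra_zeroAlgebra.union_mem hs ht)]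
      exact hm.additive ⟨s, hs⟩ ⟨t, ht⟩ ⟨s ∪ t, _⟩ hst rfl)

theorem addContent_apply (hm : IsRegularCharge m) (A : zeroAlgebra Z) :
    hm.addContent (A : Set Z) = m A :=
  dif_pos A.2

theorem apply_eq_sum (hm : IsRegularCharge m) {ι : Type*} [Fintype ι] (A : zeroAlgebra Z)
    (B : ι → zeroAlgebra Z) (hd : Pairwise fun i j => Disjoint (B i : Set Z) (B j : Set Z))
    (hA : (A : Set Z) = ⋃ i, (B i : Set Z)) : m A = ∑ i, m (B i) := by
  have h := addContent_iUnion (m := hm.addContent) (fun i => (B i).2) hd (hA ▸ A.2)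
  rw [← hA] at h
  simpa only [hm.addContent_apply] using h

theorem mono (hm : IsRegularCharge m) (h0 : ∀ A, 0 ≤ m A) {A B : zeroAlgebra Z}
    (h : (A : Set Z) ⊆ B) : m A ≤ m B := by
  have := hm.additive A ⟨B \ A, isSetAlgebra_zeroAlgebra.sdiff_mem B.2 A.2⟩ B
    disjoint_sdiff_right (union_sdiff_cancel h).symm
  have := h0 ⟨B \ A, isSetAlgebra_zeroAlgebra.sdiff_mem B.2 A.2⟩
  linarith

end IsRegularCharge

/-- The intersection of two members of `𝒰(Z)`. -/
def interZeroAlgebra (A B : zeroAlgebra Z) : zeroAlgebra Z :=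
  ⟨A ∩ B, isSetAlgebra_zeroAlgebra.inter_mem A.2 B.2⟩

theorem sum_mem_lowerSums {m : zeroAlgebra Z → ℝ} {f : Z →ᵇ ℝ} {ι : Type*} [Fintype ι]
    (A : ι → zeroAlgebra Z) (a : ι → ℝ)
    (hd : Pairwise fun i j => Disjoint (A i : Set Z) (A j : Set Z))
    (hA : (⋃ i, (A i : Set Z)) = univ) (ha : ∀ i, ∀ z ∈ (A i : Set Z), a i ≤ f z) :
    ∑ i, a i * m (A i) ∈ lowerSums m f := by
  let e := Fintype.equivFin ι
  refine ⟨Fintype.card ι, A ∘ e.symm, a ∘ e.symm, fun i j hij => ?_, ?_, fun i => ha _, ?_⟩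
  · exact hd (e.symm.injective.ne hij)
  · rw [← hA]
    exact e.symm.surjective.iUnion_comp fun i => (A i : Set Z)
  · exact (e.symm.sum_comp fun i => a i * m (A i)).symm

/-- Both step functions are rewritten on the common refinement of their partitions. This makes the
integral superadditive. -/
theorem add_mem_lowerSums {m : zeroAlgebra Z → ℝ} (hm : IsRegularCharge m) {f g : Z →ᵇ ℝ}
    {r s : ℝ} (hr : r ∈ lowerSums m f) (hs : s ∈ lowerSums m g) :
    r + s ∈ lowerSums m (f + g) := by
  obtain ⟨n, A, a, hAd, hAu, ha, rfl⟩ := hr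
  obtain ⟨k, B, b, hBd, hBu, hb, rfl⟩ := hs
  have hA : ∀ i, m (A i) = ∑ j, m (interZeroAlgebra (A i) (B j)) := fun i =>
    hm.apply_eq_sum _ _ (fun j j' hj => (hBd hj).mono inter_subset_right inter_subset_right)
      (by simp only [interZeroAlgebra]; rw [← inter_iUnion, hBu, inter_univ])
  have hB : ∀ j, m (B j) = ∑ i, m (interZeroAlgebra (A i) (B j)) := fun j =>
    hm.apply_eq_sum _ _ (fun i i' hi => (hAd hi).mono inter_subset_left inter_subset_left)
      (by simp only [interZeroAlgebra]; rw [← iUnion_inter, hAu, univ_inter])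
  have key : ∑ i, a i * m (A i) + ∑ j, b j * m (B j) =
      ∑ p : Fin n × Fin k, (a p.1 + b p.2) * m (interZeroAlgebra (A p.1) (B p.2)) := by
    simp only [hA, hB, Finset.mul_sum, add_mul, Finset.sum_add_distrib, Fintype.sum_prod_type]
    congr 1
    exact Finset.sum_comm
  rw [key]
  refine sum_mem_lowerSums (fun p : Fin n × Fin k => interZeroAlgebra (A p.1) (B p.2))
    (fun p => a p.1 + b p.2) ?_ ?_ ?_
  · rintro ⟨i, j⟩ ⟨i', j'⟩ h
    rcases eq_or_ne i i' with rfl | hi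
    · have hj : j ≠ j' := fun hj => h (by rw [hj])
      exact (hBd hj).mono inter_subset_right inter_subset_right
    · exact (hAd hi).mono inter_subset_left inter_subset_left
  · refine eq_univ_of_forall fun z => ?_
    obtain ⟨i, hi⟩ := mem_iUnion.1 (hAu.symm ▸ mem_univ z : z ∈ ⋃ i, (A i : Set Z))
    obtain ⟨j, hj⟩ := mem_iUnion.1 (hBu.symm ▸ mem_univ z : z ∈ ⋃ j, (B j : Set Z))
    exact mem_iUnion.2 ⟨(i, j), hi, hj⟩
  · rintro ⟨i, j⟩ z ⟨hz, hz'⟩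
    exact add_le_add (ha i z hz) (hb j z hz')

theorem smul_mem_lowerSums {m : zeroAlgebra Z → ℝ} {f : Z →ᵇ ℝ} {r t : ℝ} (ht : 0 ≤ t)
    (hr : r ∈ lowerSums m f) : t * r ∈ lowerSums m (t • f) := by
  obtain ⟨n, A, a, hAd, hAu, ha, rfl⟩ := hr
  refine ⟨n, A, fun i => t * a i, hAd, hAu, fun i z hz => ?_, ?_⟩
  · exact mul_le_mul_of_nonneg_left (ha i z hz) ht
  · rw [Finset.mul_sum]
    exact Finset.sum_congr rfl fun i _ => by ring

theorem const_mem_lowerSums {m : zeroAlgebra Z → ℝ} (hm : m ∈ unitCharges Z) {f : Z →ᵇ ℝ}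
    {a : ℝ} (ha : ∀ z, a ≤ f z) : a ∈ lowerSums m f := by
  refine ⟨1, fun _ => ⟨univ, univ_mem_zeroAlgebra Z⟩, fun _ => a, fun i j hij => ?_, ?_,
    fun _ z _ => ha z, ?_⟩
  · exact absurd (Subsingleton.elim i j) hij
  · exact iUnion_const _
  · simp [hm.2.2]

theorem le_of_mem_lowerSums {m : zeroAlgebra Z → ℝ} (hm : m ∈ unitCharges Z) {f : Z →ᵇ ℝ}
    {r b : ℝ} (hb : ∀ z, f z ≤ b) (hr : r ∈ lowerSums m f) : r ≤ b := by
  obtain ⟨n, A, a, hAd, hAu, ha, rfl⟩ := hr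
  have hb1 : b = ∑ i, b * m (A i) := by
    rw [← Finset.mul_sum, ← hm.1.apply_eq_sum ⟨univ, univ_mem_zeroAlgebra Z⟩ A hAd hAu.symm,
      hm.2.2, mul_one]
  rw [hb1]
  refine Finset.sum_le_sum fun i _ => ?_
  rcases (A i : Set Z).eq_empty_or_nonempty with h | ⟨z, hz⟩
  · simp [hm.1.apply_empty h]
  · exact mul_le_mul_of_nonneg_right ((ha i z hz).trans (hb z)) (hm.2.1 _)

theorem bddAbove_lowerSums {m : zeroAlgebra Z → ℝ} (hm : m ∈ unitCharges Z) (f : Z →ᵇ ℝ) :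
    BddAbove (lowerSums m f) :=
  ⟨‖f‖, fun _ hr => le_of_mem_lowerSums hm (fun z => (le_abs_self _).trans (f.norm_coe_le_norm z))
    hr⟩

theorem lowerSums_nonempty {m : zeroAlgebra Z → ℝ} (hm : m ∈ unitCharges Z) (f : Z →ᵇ ℝ) :
    (lowerSums m f).Nonempty :=
  ⟨-‖f‖, const_mem_lowerSums hm fun z => (abs_le.1 (f.norm_coe_le_norm z)).1⟩

theorem chargeIntegral_le {m : zeroAlgebra Z → ℝ} (hm : m ∈ unitCharges Z) {f : Z →ᵇ ℝ}
    {b : ℝ} (hb : ∀ z, f z ≤ b) : chargeIntegral m f ≤ b :=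
  csSup_le (lowerSums_nonempty hm f) fun _ => le_of_mem_lowerSums hm hb

theorem le_chargeIntegral {m : zeroAlgebra Z → ℝ} (hm : m ∈ unitCharges Z) {f : Z →ᵇ ℝ}
    {a : ℝ} (ha : ∀ z, a ≤ f z) : a ≤ chargeIntegral m f :=
  le_csSup (bddAbove_lowerSums hm f) (const_mem_lowerSums hm ha)

theorem chargeIntegral_add_le {m : zeroAlgebra Z → ℝ} (hm : m ∈ unitCharges Z) (f g : Z →ᵇ ℝ) :
    chargeIntegral m f + chargeIntegral m g ≤ chargeIntegral m (f + g) := by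
  have h1 : ∀ r ∈ lowerSums m f, chargeIntegral m g ≤ chargeIntegral m (f + g) - r := fun r hr =>
    csSup_le (lowerSums_nonempty hm g) fun s hs => by
      have := le_csSup (bddAbove_lowerSums hm (f + g)) (add_mem_lowerSums hm.1 hr hs)
      simp only [chargeIntegral] at *
      linarith
  have h2 : chargeIntegral m f ≤ chargeIntegral m (f + g) - chargeIntegral m g :=
    csSup_le (lowerSums_nonempty hm f) fun r hr => by linarith [h1 r hr]
  linarith

/-- Slicing the range of `f` into slabs `[kδ, (k+1)δ)` gives the lower step values `kδ` for `f` and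
`-(k+1)δ` for `-f`. They add up to `-δ` on each slab, and the total mass is one. So lower and upper
integrals agree. -/
theorem exists_lowerSums_add_eq_neg {m : zeroAlgebra Z → ℝ} (hm : m ∈ unitCharges Z)
    (f : Z →ᵇ ℝ) {δ : ℝ} (hδ : 0 < δ) :
    ∃ r ∈ lowerSums m f, ∃ s ∈ lowerSums m (-f), r + s = -δ := by
  let S : Finset ℤ := Finset.Icc ⌊-‖f‖ / δ⌋ ⌊‖f‖ / δ⌋
  have hlevel : ∀ k : ℤ, {z | ⌊f z / δ⌋ = k} ∈ zeroAlgebra Z := fun k => by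
    have h : {z | ⌊f z / δ⌋ = k} = {z | (k : ℝ) * δ ≤ f z} \ {z | ((k : ℝ) + 1) * δ ≤ f z} := by
      ext z
      simp only [mem_ofPred_eq, mem_sdiff, Int.floor_eq_iff, not_le, le_div_iff₀ hδ, div_lt_iff₀ hδ]
    rw [h]
    exact isSetAlgebra_zeroAlgebra.sdiff_mem
      (mem_zeroAlgebra_of_mem_zeroSets (setOf_le_mem_zeroSets f.continuous _))
      (mem_zeroAlgebra_of_mem_zeroSets (setOf_le_mem_zeroSets f.continuous _))
  let A : S → zeroAlgebra Z := fun k => ⟨_, hlevel k⟩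
  have hd : Pairwise fun i j => Disjoint (A i : Set Z) (A j : Set Z) := fun i j hij =>
    disjoint_left.2 fun z hi hj => hij (Subtype.ext (hi.symm.trans hj))
  have hu : (⋃ i, (A i : Set Z)) = univ := eq_univ_of_forall fun z => by
    have hz := abs_le.1 (f.norm_coe_le_norm z)
    refine mem_iUnion.2
      ⟨⟨⌊f z / δ⌋, Finset.mem_Icc.2 ⟨Int.floor_le_floor ?_, Int.floor_le_floor ?_⟩⟩, rfl⟩
    · exact div_le_div_of_nonneg_right hz.1 hδ.le
    · exact div_le_div_of_nonneg_right hz.2 hδ.le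
  refine ⟨_, sum_mem_lowerSums A (fun k => (k : ℤ) * δ) hd hu fun k z hz => ?_,
    _, sum_mem_lowerSums A (fun k => -(((k : ℤ) + 1) * δ)) hd hu fun k z hz => ?_, ?_⟩
  · have hz' : ⌊f z / δ⌋ = (k : ℤ) := hz
    exact (le_div_iff₀ hδ).1 (Int.floor_eq_iff.1 hz').1
  · have hz' : ⌊f z / δ⌋ = (k : ℤ) := hz
    have := (div_lt_iff₀ hδ).1 (Int.floor_eq_iff.1 hz').2
    simp only [BoundedContinuousFunction.coe_neg, Pi.neg_apply]
    linarith
  · rw [← Finset.sum_add_distrib]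
    have h1 : ∀ k : S, ((k : ℤ) : ℝ) * δ * m (A k) + -((((k : ℤ) : ℝ) + 1) * δ) * m (A k) =
        (-δ) * m (A k) := fun k => by ring
    simp only [h1]
    rw [← Finset.mul_sum, ← hm.1.apply_eq_sum ⟨univ, univ_mem_zeroAlgebra Z⟩ A hd hu.symm,
      hm.2.2, mul_one]

theorem chargeIntegral_neg {m : zeroAlgebra Z → ℝ} (hm : m ∈ unitCharges Z) (f : Z →ᵇ ℝ) :
    chargeIntegral m (-f) = -chargeIntegral m f := by
  have h1 := chargeIntegral_add_le hm f (-f)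
  have h2 : chargeIntegral m (f + -f) ≤ 0 := chargeIntegral_le hm (by simp)
  have h3 : 0 ≤ chargeIntegral m f + chargeIntegral m (-f) := by
    refine le_of_forall_pos_le_add fun δ hδ => ?_
    obtain ⟨r, hr, s, hs, hrs⟩ := exists_lowerSums_add_eq_neg hm f hδ
    have := le_csSup (bddAbove_lowerSums hm f) hr
    have := le_csSup (bddAbove_lowerSums hm (-f)) hs
    simp only [chargeIntegral] at *
    linarith
  linarith

theorem chargeIntegral_add {m : zeroAlgebra Z → ℝ} (hm : m ∈ unitCharges Z) (f g : Z →ᵇ ℝ) :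
    chargeIntegral m (f + g) = chargeIntegral m f + chargeIntegral m g := by
  refine le_antisymm ?_ (chargeIntegral_add_le hm f g)
  -- Superadditivity for `-f` and `-g` is subadditivity for `f` and `g`.
  have := chargeIntegral_add_le hm (-f) (-g)
  rw [← neg_add, chargeIntegral_neg hm, chargeIntegral_neg hm, chargeIntegral_neg hm] at this
  linarith

theorem chargeIntegral_smul {m : zeroAlgebra Z → ℝ} (hm : m ∈ unitCharges Z) (t : ℝ)
    (f : Z →ᵇ ℝ) : chargeIntegral m (t • f) = t * chargeIntegral m f := by
  have hle : ∀ (t : ℝ) (f : Z →ᵇ ℝ), 0 < t →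
      t * chargeIntegral m f ≤ chargeIntegral m (t • f) := fun t f ht => by
    rw [← le_div_iff₀' ht]
    refine csSup_le (lowerSums_nonempty hm f) fun r hr => ?_
    rw [le_div_iff₀' ht]
    exact le_csSup (bddAbove_lowerSums hm _) (smul_mem_lowerSums ht.le hr)
  have hpos : ∀ (t : ℝ) (f : Z →ᵇ ℝ), 0 < t →
      chargeIntegral m (t • f) = t * chargeIntegral m f := fun t f ht => by
    refine le_antisymm ?_ (hle t f ht)
    have := hle t⁻¹ (t • f) (inv_pos.2 ht)
    rwa [smul_smul, inv_mul_cancel₀ ht.ne', one_smul, inv_mul_le_iff₀ ht] at this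
  rcases lt_trichotomy t 0 with ht | rfl | ht
  · have := hpos (-t) f (neg_pos.2 ht)
    rw [show -t • f = -(t • f) by ext z; simp, chargeIntegral_neg hm] at this
    linarith
  · rw [zero_smul, zero_mul]
    exact le_antisymm (chargeIntegral_le hm (by simp)) (le_chargeIntegral hm (by simp))
  · exact hpos t f ht

end ChargeIntegral

/-! ### Means on `C_b(Z)`, and charges as means. -/

section Means

/-- Positive normalized linear functionals on `C_b(Z)`. -/
structure IsMean {Z : Type u} [TopologicalSpace Z] (I : (Z →ᵇ ℝ) → ℝ) : Prop where
  map_add : ∀ f g, I (f + g) = I f + I g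
  map_smul : ∀ (t : ℝ) f, I (t • f) = t * I f
  nonneg : ∀ f : Z →ᵇ ℝ, (∀ z, 0 ≤ f z) → 0 ≤ I f
  map_one : I 1 = 1

variable {Z : Type u} [TopologicalSpace Z]

namespace IsMean

variable {I : (Z →ᵇ ℝ) → ℝ}

theorem mono (hI : IsMean I) {f g : Z →ᵇ ℝ} (h : ∀ z, f z ≤ g z) : I f ≤ I g := by
  have h1 := hI.map_add f (g - f)
  have h2 := hI.nonneg (g - f) fun z => sub_nonneg.2 (h z)
  rw [add_sub_cancel] at h1
  linarith

theorem map_const (hI : IsMean I) (t : ℝ) : I (t • (1 : Z →ᵇ ℝ)) = t := by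
  rw [hI.map_smul, hI.map_one, mul_one]

theorem abs_le_norm (hI : IsMean I) (f : Z →ᵇ ℝ) : |I f| ≤ ‖f‖ := by
  have h := fun z => abs_le.1 (f.norm_coe_le_norm z)
  rw [abs_le]
  constructor
  · rw [← hI.map_const (-‖f‖)]
    exact hI.mono fun z => by simpa using (h z).1
  · rw [← hI.map_const ‖f‖]
    exact hI.mono fun z => by simpa using (h z).2

end IsMean

theorem isMean_chargeIntegral {m : zeroAlgebra Z → ℝ} (hm : m ∈ unitCharges Z) :
    IsMean (chargeIntegral m) where
  map_add := chargeIntegral_add hm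
  map_smul := chargeIntegral_smul hm
  nonneg _ := le_chargeIntegral hm
  map_one := le_antisymm (chargeIntegral_le hm (by simp)) (le_chargeIntegral hm (by simp))

theorem zeroSet_separation {F G : Set Z} (hF : F ∈ zeroSets Z) (hG : G ∈ zeroSets Z)
    (hFG : Disjoint F G) : ∃ f : Z →ᵇ ℝ, (∀ z, 0 ≤ f z) ∧ (∀ z, f z ≤ 1) ∧ (∀ z ∈ F, f z = 1) ∧
      ∀ z ∈ G, f z = 0 := by
  -- The separating function is `|q| / (|p| + |q|)`; disjointness keeps the denominator positive.
  obtain ⟨p, rfl⟩ := hF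
  obtain ⟨q, rfl⟩ := hG
  have hpos : ∀ z, 0 < |p z| + |q z| := fun z => by
    by_contra h
    have hp : p z = 0 := abs_nonpos_iff.1 (by linarith [abs_nonneg (q z)])
    have hq : q z = 0 := abs_nonpos_iff.1 (by linarith [abs_nonneg (p z)])
    exact disjoint_left.1 hFG hp hq
  have h0 : ∀ z, 0 ≤ |q z| / (|p z| + |q z|) := fun z => by positivity
  have h1 : ∀ z, |q z| / (|p z| + |q z|) ≤ 1 := fun z =>
    (div_le_one (hpos z)).2 (by linarith [abs_nonneg (p z)])
  refine ⟨.ofNormedAddCommGroup (fun z => |q z| / (|p z| + |q z|)) ?_ 1 ?_, h0, h1, ?_, ?_⟩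
  · exact Continuous.div (by fun_prop) (by fun_prop) fun z => (hpos z).ne'
  · exact fun z => by rw [Real.norm_eq_abs, abs_of_nonneg (h0 z)]; exact h1 z
  · intro z hz
    have hz' : p z = 0 := hz
    have := hpos z
    rw [hz', abs_zero, zero_add] at this
    simp [hz', this.ne']
  · intro z hz
    have hz' : q z = 0 := hz
    simp [hz']

theorem apply_le_chargeIntegral {m : zeroAlgebra Z → ℝ} (hm : m ∈ unitCharges Z)
    {F : zeroAlgebra Z} {f : Z →ᵇ ℝ} (h0 : ∀ z, 0 ≤ f z) (h1 : ∀ z ∈ (F : Set Z), 1 ≤ f z) :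
    m F ≤ chargeIntegral m f := by
  have h := sum_mem_lowerSums (m := m) (f := f) (ι := Bool)
    (fun i => if i then F else ⟨(F : Set Z)ᶜ, isSetAlgebra_zeroAlgebra.compl_mem F.2⟩)
    (fun i => if i then 1 else 0) ?_ ?_ ?_
  · simp only [Fintype.sum_bool, if_true, one_mul, Bool.false_eq_true, if_false, zero_mul,
      add_zero] at h
    exact le_csSup (bddAbove_lowerSums hm f) h
  · rintro (_ | _) (_ | _) h
    · exact absurd rfl h
    · exact disjoint_compl_left
    · exact disjoint_compl_right
    · exact absurd rfl h
  · refine eq_univ_of_forall fun z => mem_iUnion.2 ?_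
    by_cases hz : z ∈ (F : Set Z)
    · exact ⟨true, hz⟩
    · exact ⟨false, hz⟩
  · rintro (_ | _) z hz
    · exact h0 z
    · exact h1 z hz

/-- This is `apply_le_chargeIntegral` for the complement of `A` and the function `1 - f`. -/
theorem chargeIntegral_le_apply {m : zeroAlgebra Z → ℝ} (hm : m ∈ unitCharges Z)
    {A : zeroAlgebra Z} {f : Z →ᵇ ℝ} (h1 : ∀ z, f z ≤ 1) (h0 : ∀ z ∉ (A : Set Z), f z ≤ 0) :
    chargeIntegral m f ≤ m A := by
  let B : zeroAlgebra Z := ⟨(A : Set Z)ᶜ, isSetAlgebra_zeroAlgebra.compl_mem A.2⟩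
  have hB : m B ≤ chargeIntegral m (1 - f) := apply_le_chargeIntegral hm
    (fun z => by simpa using h1 z) fun z hz => by simpa using h0 z hz
  have h := hm.1.additive A B ⟨univ, univ_mem_zeroAlgebra Z⟩ disjoint_compl_right (by simp [B])
  rw [hm.2.2] at h
  have hI := isMean_chargeIntegral hm
  have h2 := hI.map_add f (1 - f)
  rw [add_sub_cancel, hI.map_one] at h2
  linarith

/-- A regular unit charge is determined by its integrals of bounded continuous functions. -/
theorem unitCharges_ext {m n : zeroAlgebra Z → ℝ} (hm : m ∈ unitCharges Z)
    (hn : n ∈ unitCharges Z) (h : ∀ f, chargeIntegral m f = chargeIntegral n f) : m = n := by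
  have key : ∀ {m n : zeroAlgebra Z → ℝ}, m ∈ unitCharges Z → n ∈ unitCharges Z →
      (∀ f, chargeIntegral m f = chargeIntegral n f) → ∀ A, m A ≤ n A := by
    intro m n hm hn h A
    refine le_of_forall_pos_le_add fun ε hε => ?_
    -- `F` approximates `A` from inside for `m`, and below `G` approximates `Fᶜ` from inside for
    -- `n`. A function separating `F` from `G` gives `m F ≤ n Gᶜ`, while `Gᶜ` exceeds `F` by a set
    -- of small `n`-mass.
    obtain ⟨F, hF, hFA, hFε⟩ := hm.1.regular A (ε / 2) (half_pos hε)
    let F' : zeroAlgebra Z := ⟨F, mem_zeroAlgebra_of_mem_zeroSets hF⟩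
    have hmA : m A < m F' + ε / 2 := by
      let D : zeroAlgebra Z := ⟨A \ F, isSetAlgebra_zeroAlgebra.sdiff_mem A.2 F'.2⟩
      have h1 := hm.1.additive F' D A disjoint_sdiff_right (union_sdiff_cancel hFA).symm
      have h2 := (abs_lt.1 (hFε D Subset.rfl)).2
      linarith
    let C : zeroAlgebra Z := ⟨Fᶜ, isSetAlgebra_zeroAlgebra.compl_mem F'.2⟩
    obtain ⟨G, hG, hGC, hGε⟩ := hn.1.regular C (ε / 2) (half_pos hε)
    let G' : zeroAlgebra Z := ⟨G, mem_zeroAlgebra_of_mem_zeroSets hG⟩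
    obtain ⟨f, hf0, hf1, hfF, hfG⟩ := zeroSet_separation hF hG
      (disjoint_left.2 fun z hz hz' => hGC hz' hz)
    let E : zeroAlgebra Z := ⟨Gᶜ, isSetAlgebra_zeroAlgebra.compl_mem G'.2⟩
    have h3 : m F' ≤ chargeIntegral m f :=
      apply_le_chargeIntegral hm hf0 fun z hz => (hfF z hz).ge
    have h4 : chargeIntegral n f ≤ n E :=
      chargeIntegral_le_apply hn hf1 fun z hz => (hfG z (by simpa [E] using hz)).le
    let D : zeroAlgebra Z := ⟨C \ G, isSetAlgebra_zeroAlgebra.sdiff_mem C.2 G'.2⟩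
    have h5 : n E = n F' + n D := hn.1.additive F' D E
      (disjoint_left.2 fun z hz hz' => hz'.1 hz) (by
        ext z
        simp only [E, F', D, C, mem_compl_iff, mem_union, mem_sdiff]
        have : z ∈ G → z ∉ F := fun hz => hGC hz
        tauto)
    have h6 := (abs_lt.1 (hGε D Subset.rfl)).2
    have h7 : n F' ≤ n A := hn.1.mono hn.2.1 hFA
    rw [h f] at h3
    linarith
  funext A
  exact le_antisymm (key hm hn h A) (key hn hm (fun f => (h f).symm) A)

end Means

/-! ### Restriction of measures to regular charges. -/

section MeasureCharge

variable {Z : Type u} [TopologicalSpace Z]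

theorem empty_mem_zeroSets : (∅ : Set Z) ∈ zeroSets Z :=
  ⟨1, by ext z; simp⟩

theorem univ_mem_zeroSets : (univ : Set Z) ∈ zeroSets Z :=
  ⟨0, by ext z; simp⟩

theorem union_mem_zeroSets {F G : Set Z} (hF : F ∈ zeroSets Z) (hG : G ∈ zeroSets Z) :
    F ∪ G ∈ zeroSets Z := by
  obtain ⟨f, rfl⟩ := hF
  obtain ⟨g, rfl⟩ := hG
  exact ⟨f * g, by ext z; simp⟩

theorem inter_mem_zeroSets {F G : Set Z} (hF : F ∈ zeroSets Z) (hG : G ∈ zeroSets Z) :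
    F ∩ G ∈ zeroSets Z := by
  obtain ⟨f, rfl⟩ := hF
  obtain ⟨g, rfl⟩ := hG
  refine ⟨⟨fun z => max |f z| |g z|, by fun_prop⟩, ?_⟩
  ext z
  simp only [mem_inter_iff, mem_preimage, mem_singleton_iff, ContinuousMap.coe_mk]
  constructor
  · rintro ⟨h, h'⟩
    simp [h, h']
  · intro h
    exact ⟨abs_nonpos_iff.1 (h ▸ le_max_left _ _), abs_nonpos_iff.1 (h ▸ le_max_right _ _)⟩

variable [MeasurableSpace Z] [BorelSpace Z]

theorem measurableSet_of_mem_zeroSets {A : Set Z} (hA : A ∈ zeroSets Z) : MeasurableSet A := by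
  obtain ⟨f, rfl⟩ := hA
  exact (isClosed_singleton.preimage f.continuous).measurableSet

theorem measurableSet_of_mem_zeroAlgebra {A : Set Z} (hA : A ∈ zeroAlgebra Z) :
    MeasurableSet A := by
  induction hA with
  | base A hA => exact measurableSet_of_mem_zeroSets hA
  | empty => exact .empty
  | compl A _ ih => exact ih.compl
  | union A B _ _ ihA ihB => exact ihA.union ihB

/-- The two-sided form is what survives induction over the algebra: complementation swaps the inner
zero-set with the complement of the outer cozero-set. A zero-set of `f` is the decreasing
intersection of the cozero-sets `|f| < 1/(n+1)`, so continuity from above settles the base case. -/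
theorem exists_zeroSet_cozeroSet_approx (γ : Measure Z) [IsFiniteMeasure γ] {A : Set Z}
    (hA : A ∈ zeroAlgebra Z) {ε : ENNReal} (hε : 0 < ε) :
    ∃ F ∈ zeroSets Z, ∃ G ∈ zeroSets Z, F ⊆ A ∧ A ⊆ Gᶜ ∧ γ (Gᶜ \ F) < ε := by
  induction hA generalizing ε with
  | base A hA =>
    obtain ⟨f, hf⟩ := id hA
    let D : ℕ → Set Z := fun n => {z | (1 : ℝ) / (n + 1) ≤ |f z|}ᶜ \ A
    have hD : ∀ n, MeasurableSet (D n) := fun n =>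
      (measurableSet_of_mem_zeroSets (setOf_le_mem_zeroSets (by fun_prop) _)).compl.diff
        (measurableSet_of_mem_zeroSets hA)
    have hanti : Antitone D := fun n k hnk z hz => by
      refine ⟨fun h => hz.1 ?_, hz.2⟩
      simp only [mem_ofPred_eq] at h ⊢
      exact (Nat.one_div_le_one_div hnk).trans h
    have hempty : ⋂ n, D n = ∅ := by
      refine eq_empty_of_forall_notMem fun z hz => ?_
      have hz' := mem_iInter.1 hz
      have hpos : 0 < |f z| := abs_pos.2 fun h => (hz' 0).2 (by rw [hf]; exact h)
      obtain ⟨n, hn⟩ := exists_nat_one_div_lt hpos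
      exact (hz' n).1 hn.le
    have hlim := tendsto_measure_iInter_atTop (μ := γ) (fun n => (hD n).nullMeasurableSet) hanti
      ⟨0, measure_ne_top _ _⟩
    rw [hempty, measure_empty] at hlim
    obtain ⟨n, hn⟩ := (hlim.eventually (gt_mem_nhds hε)).exists
    refine ⟨A, hA, _, setOf_le_mem_zeroSets (f := fun z => |f z|) (by fun_prop) _, Subset.rfl,
      fun z hz => ?_, hn⟩
    have hz' : f z = 0 := by rw [hf] at hz; exact hz
    simp only [mem_compl_iff, mem_ofPred_eq, hz', abs_zero, not_le]
    positivity
  | empty => exact ⟨∅, empty_mem_zeroSets, univ, univ_mem_zeroSets, Subset.rfl, by simp, by simpa⟩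
  | compl A _ ih =>
    obtain ⟨F, hF, G, hG, hFA, hAG, h⟩ := ih hε
    refine ⟨G, hG, F, hF, subset_compl_comm.1 hAG, compl_subset_compl.2 hFA, ?_⟩
    rwa [Set.sdiff_eq, inter_comm, ← Set.sdiff_eq]
  | union A B _ _ ihA ihB =>
    obtain ⟨F, hF, G, hG, hFA, hAG, h⟩ := ihA (ENNReal.half_pos hε.ne')
    obtain ⟨F', hF', G', hG', hFB, hBG, h'⟩ := ihB (ENNReal.half_pos hε.ne')
    refine ⟨F ∪ F', union_mem_zeroSets hF hF', G ∩ G', inter_mem_zeroSets hG hG',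
      union_subset_union hFA hFB, ?_, ?_⟩
    · rw [compl_inter]
      exact union_subset_union hAG hBG
    · calc γ ((G ∩ G')ᶜ \ (F ∪ F')) ≤ γ ((Gᶜ \ F) ∪ (G'ᶜ \ F')) := by
            refine measure_mono fun z hz => ?_
            simp only [mem_sdiff, mem_compl_iff, mem_inter_iff, mem_union] at hz ⊢
            tauto
        _ ≤ γ (Gᶜ \ F) + γ (G'ᶜ \ F') := measure_union_le _ _
        _ < ε / 2 + ε / 2 := ENNReal.add_lt_add h h'
        _ = ε := ENNReal.add_halves ε

/-- The restriction of a measure to `𝒰(Z)`. -/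
noncomputable def measureCharge (γ : Measure Z) : zeroAlgebra Z → ℝ :=
  fun A => (γ (A : Set Z)).toReal

theorem measureCharge_mem_unitCharges (γ : Measure Z) [IsProbabilityMeasure γ] :
    measureCharge γ ∈ unitCharges Z := by
  refine ⟨⟨fun A B C hAB hC => ?_, ⟨1, fun A => ?_⟩, fun A ε hε => ?_⟩,
    fun A => ENNReal.toReal_nonneg, by simp [measureCharge]⟩
  · simp only [measureCharge, hC]
    exact measureReal_union hAB (measurableSet_of_mem_zeroAlgebra B.2)
  · simp only [measureCharge, abs_of_nonneg ENNReal.toReal_nonneg]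
    exact measureReal_le_one
  · obtain ⟨F, hF, G, hG, hFA, hAG, h⟩ :=
      exists_zeroSet_cozeroSet_approx γ A.2 (ENNReal.ofReal_pos.2 hε)
    refine ⟨F, hF, hFA, fun B hB => ?_⟩
    simp only [measureCharge, abs_of_nonneg ENNReal.toReal_nonneg]
    exact (ENNReal.lt_ofReal_iff_toReal_lt (measure_ne_top _ _)).1
      ((measure_mono (hB.trans (sdiff_subset_sdiff_left hAG))).trans_lt h)

theorem integrable_boundedContinuous (γ : Measure Z) [IsFiniteMeasure γ] (f : Z →ᵇ ℝ) :
    Integrable f γ :=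
  .of_bound f.continuous.measurable.aestronglyMeasurable ‖f‖ (.of_forall f.norm_coe_le_norm)

theorem chargeIntegral_measureCharge (γ : Measure Z) [IsProbabilityMeasure γ] (f : Z →ᵇ ℝ) :
    chargeIntegral (measureCharge γ) f = ∫ z, f z ∂γ := by
  have hm := measureCharge_mem_unitCharges γ
  have hle : ∀ f : Z →ᵇ ℝ, chargeIntegral (measureCharge γ) f ≤ ∫ z, f z ∂γ := fun f => by
    refine csSup_le (lowerSums_nonempty hm f) ?_
    rintro _ ⟨n, A, a, hd, hu, ha, rfl⟩
    have hA := fun i => measurableSet_of_mem_zeroAlgebra (A i).2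
    rw [← setIntegral_univ, ← hu, integral_iUnion_fintype hA hd fun i =>
      (integrable_boundedContinuous γ f).integrableOn]
    refine Finset.sum_le_sum fun i _ => ?_
    rw [mul_comm]
    exact setIntegral_ge_of_const_le (hA i) (measure_ne_top _ _) (ha i)
      (integrable_boundedContinuous γ f).integrableOn
  refine le_antisymm (hle f) ?_
  -- Applied to `-f`, the same bound is the reverse inequality.
  have h := hle (-f)
  rw [chargeIntegral_neg hm] at h
  simp only [BoundedContinuousFunction.coe_neg, Pi.neg_apply, integral_neg] at h
  linarith

theorem isMean_integral (γ : Measure Z) [IsProbabilityMeasure γ] :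
    IsMean fun f : Z →ᵇ ℝ => ∫ z, f z ∂γ := by
  rw [← funext (chargeIntegral_measureCharge γ)]
  exact isMean_chargeIntegral (measureCharge_mem_unitCharges γ)

end MeasureCharge

/-! ### Radon measures and their determination by continuous functions. -/

section Radon

variable {Z : Type u} [TopologicalSpace Z] [MeasurableSpace Z] [BorelSpace Z]

theorem IsRadonProbability.innerRegularCompactLTTop {Z : Type u} [TopologicalSpace Z]
    [MeasurableSpace Z] {γ : Measure Z} (hγ : IsRadonProbability γ) :
    γ.InnerRegularCompactLTTop where
  innerRegular := by
    have := hγ.1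
    rintro B ⟨hB, -⟩ r hr
    obtain ⟨K, hK, hKB, h⟩ := hγ.2 B hB (γ B - r) (tsub_pos_of_lt hr)
    refine ⟨K, hKB, hK, ?_⟩
    by_contra hle
    refine lt_irrefl (γ B) ?_
    calc γ B ≤ γ (B \ K ∪ K) := measure_mono (subset_sdiff_union _ _)
      _ ≤ γ (B \ K) + γ K := measure_union_le _ _
      _ < (γ B - r) + r := ENNReal.add_lt_add_of_lt_of_le
          ((not_lt.1 hle).trans_lt (hr.trans (measure_lt_top _ _))).ne h (not_lt.1 hle)
      _ = γ B := tsub_add_cancel_of_le hr.le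

/-- In a Tychonoff space a compact set and a closed set disjoint from it are separated by a
bounded continuous function. -/
theorem exists_boundedContinuous_separation {Z : Type u} [TopologicalSpace Z] [T35Space Z]
    {K U : Set Z} (hK : IsCompact K) (hU : IsOpen U) (hKU : K ⊆ U) :
    ∃ f : Z →ᵇ ℝ, (∀ z, 0 ≤ f z) ∧ (∀ z, f z ≤ 1) ∧ (∀ z ∈ K, f z = 1) ∧ ∀ z ∉ U, f z = 0 := by
  -- The separation is done by Urysohn's lemma in the Stone–Čech compactification, where the image
  -- of `K` is closed.
  obtain ⟨V, hV, rfl⟩ := isEmbedding_stoneCechUnit.isInducing.isOpen_iff.1 hU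
  obtain ⟨g, hg0, hg1, hg⟩ := exists_continuous_zero_one_of_isClosed hV.isClosed_compl
    (hK.image continuous_stoneCechUnit).isClosed
    (disjoint_left.2 (by rintro _ hz ⟨z, hzK, rfl⟩; exact hz (hKU hzK)))
  refine ⟨(mkOfCompact g).compContinuous ⟨stoneCechUnit, continuous_stoneCechUnit⟩,
    fun z => (hg _).1, fun z => (hg _).2, fun z hz => hg1 (mem_image_of_mem _ hz),
    fun z hz => hg0 hz⟩

/-- Radon measures on a Tychonoff space are determined by the integrals of bounded continuous
functions. -/
theorem measure_ext_of_integral_eq [T35Space Z] {γ η : Measure Z} [IsProbabilityMeasure γ]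
    [IsProbabilityMeasure η] [γ.InnerRegularCompactLTTop] [η.InnerRegularCompactLTTop]
    (h : ∀ f : Z →ᵇ ℝ, ∫ z, f z ∂γ = ∫ z, f z ∂η) : γ = η := by
  have key : ∀ {γ η : Measure Z} [IsProbabilityMeasure γ] [IsProbabilityMeasure η]
      [γ.InnerRegularCompactLTTop] [η.InnerRegularCompactLTTop],
      (∀ f : Z →ᵇ ℝ, ∫ z, f z ∂γ = ∫ z, f z ∂η) → ∀ K, IsCompact K → γ K ≤ η K := by
    intro γ η _ _ _ _ h K hK
    -- Outer regularity of `η` reduces the bound to `γ K ≤ ∫ f dγ = ∫ f dη ≤ η U`. Agreement on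
    -- compact sets then passes to Borel sets by inner regularity.
    refine ENNReal.le_of_forall_pos_le_add fun ε hε _ => ?_
    obtain ⟨U, hKU, hU, hUε⟩ := K.exists_isOpen_le_add η (ENNReal.coe_pos.2 hε).ne'
    obtain ⟨f, hf0, hf1, hfK, hfU⟩ := exists_boundedContinuous_separation hK hU hKU
    have h1 : (γ K).toReal ≤ ∫ z, f z ∂γ := by
      have := integral_mono (μ := γ) (f := K.indicator 1)
        ((integrable_const (1 : ℝ)).indicator hK.measurableSet) (integrable_boundedContinuous γ f)
        (fun z => by
          by_cases hz : z ∈ K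
          · simp [hz, hfK z hz]
          · simp [hz, hf0 z])
      rwa [integral_indicator_one hK.measurableSet] at this
    have h2 : ∫ z, f z ∂η ≤ (η U).toReal := by
      have := integral_mono (μ := η) (g := U.indicator 1) (integrable_boundedContinuous η f)
        ((integrable_const (1 : ℝ)).indicator hU.measurableSet)
        (fun z => by
          by_cases hz : z ∈ U
          · simp [hz, hf1 z]
          · simp [hz, hfU z hz])
      rwa [integral_indicator_one hU.measurableSet] at this
    have h3 : γ K ≤ η U := (ENNReal.toReal_le_toReal (measure_ne_top _ _) (measure_ne_top _ _)).1
      (h1.trans ((h f).trans_le h2))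
    exact h3.trans hUε
  have hγ : γ.InnerRegular := inferInstance
  have hη : η.InnerRegular := inferInstance
  ext B hB
  exact hγ.innerRegular.eq_of_innerRegularWRT_of_forall_eq hη.innerRegular
    (fun K hK => le_antisymm (key h K hK) (key (fun f => (h f).symm) K hK)) hB

end Radon

/-! ### Riesz representation of tight means. -/

section Riesz

variable {Z : Type u} [TopologicalSpace Z]

/-- A functional on `C_b(Z)` is tight if it is small on functions with values in `[0, 1]` that
vanish on a suitable compact set. -/
def IsTightMean (I : (Z →ᵇ ℝ) → ℝ) : Prop :=
  ∀ ε : ℝ, 0 < ε → ∃ K : Set Z, IsCompact K ∧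
    ∀ f : Z →ᵇ ℝ, (∀ z, 0 ≤ f z) → (∀ z, f z ≤ 1) → (∀ z ∈ K, f z = 0) → I f ≤ ε

/-- Restriction to `Z` of a continuous function on the Stone–Čech compactification. -/
noncomputable def restrictStoneCech (g : C(StoneCech Z, ℝ)) : Z →ᵇ ℝ :=
  (mkOfCompact g).compContinuous ⟨stoneCechUnit, continuous_stoneCechUnit⟩

theorem exists_stoneCech_extension (f : Z →ᵇ ℝ) :
    ∃ g : C(StoneCech Z, ℝ), ∀ z, g (stoneCechUnit z) = f z := by
  have hf : ∀ z, f z ∈ Icc (-‖f‖) ‖f‖ := fun z => abs_le.1 (f.norm_coe_le_norm z)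
  have hc : Continuous fun z => (⟨f z, hf z⟩ : Icc (-‖f‖) ‖f‖) := by fun_prop
  refine ⟨⟨fun p => ((stoneCechExtend hc p : Icc (-‖f‖) ‖f‖) : ℝ),
    continuous_subtype_val.comp (continuous_stoneCechExtend hc)⟩, fun z => ?_⟩
  simp [stoneCechExtend_stoneCechUnit]

/-- The positive functional on `C(βZ)` induced by a mean on `C_b(Z)`. -/
noncomputable def IsMean.stoneCechFunctional {I : (Z →ᵇ ℝ) → ℝ} (hI : IsMean I) :
    CompactlySupportedContinuousMap (StoneCech Z) ℝ →ₚ[ℝ] ℝ :=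
  PositiveLinearMap.mk₀
    { toFun := fun g => I (restrictStoneCech (g : C(StoneCech Z, ℝ)))
      map_add' := fun g h => by rw [← hI.map_add]; rfl
      map_smul' := fun t g => by rw [RingHom.id_apply, smul_eq_mul, ← hI.map_smul]; rfl }
    fun g hg => hI.nonneg _ fun z => hg (stoneCechUnit z)

theorem IsMean.exists_measure_stoneCech {I : (Z →ᵇ ℝ) → ℝ} (hI : IsMean I)
    [MeasurableSpace (StoneCech Z)] [BorelSpace (StoneCech Z)] :
    ∃ η : Measure (StoneCech Z), IsProbabilityMeasure η ∧ η.Regular ∧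
      ∀ g : C(StoneCech Z, ℝ), ∫ p, g p ∂η = I (restrictStoneCech g) := by
  let η := RealRMK.rieszMeasure hI.stoneCechFunctional
  have hη : ∀ g : C(StoneCech Z, ℝ), ∫ p, g p ∂η = I (restrictStoneCech g) := fun g =>
    RealRMK.integral_rieszMeasure hI.stoneCechFunctional
      (CompactlySupportedContinuousMap.continuousMapEquiv g)
  refine ⟨η, ⟨?_⟩, inferInstance, hη⟩
  have h1 := hη 1
  have h2 : I (restrictStoneCech 1) = 1 := hI.map_one
  simp only [ContinuousMap.one_apply, integral_const, smul_eq_mul, mul_one, h2] at h1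
  -- The integral of `1` only sees the real-valued mass; being `1` and not the default `0`, it
  -- excludes infinite mass.
  exact (ENNReal.toReal_eq_one_iff _).1 h1

/-- `Z` need not be Borel in its compactification, so the embedding is inverted only on the
σ-compact set `⋃ K n` and set constant elsewhere. Preimages of closed sets are then countable unions
of compact sets, up to the complement of that σ-compact set. -/
theorem exists_measurable_retraction [T35Space Z] [Nonempty Z] [MeasurableSpace Z] [BorelSpace Z]
    [MeasurableSpace (StoneCech Z)] [BorelSpace (StoneCech Z)] {K : ℕ → Set Z}
    (hK : ∀ n, IsCompact (K n)) :
    ∃ r : StoneCech Z → Z, Measurable r ∧ ∀ p ∈ ⋃ n, stoneCechUnit '' K n,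
      stoneCechUnit (r p) = p := by
  classical
  have hemb : Topology.IsEmbedding (stoneCechUnit : Z → StoneCech Z) := isEmbedding_stoneCechUnit
  let S : Set (StoneCech Z) := ⋃ n, stoneCechUnit '' K n
  have hS : MeasurableSet S := .iUnion fun n =>
    ((hK n).image continuous_stoneCechUnit).isClosed.measurableSet
  let z₀ : Z := Classical.arbitrary Z
  let r : StoneCech Z → Z := fun p => if p ∈ S then Function.invFun stoneCechUnit p else z₀
  have hr : ∀ p ∈ S, stoneCechUnit (r p) = p := fun p hp => by
    simp only [r, if_pos hp]
    obtain ⟨n, z, -, rfl⟩ := mem_iUnion.1 hp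
    exact Function.invFun_eq ⟨z, rfl⟩
  refine ⟨r, measurable_of_isClosed fun C hC => ?_, hr⟩
  have h1 : r ⁻¹' C ∩ S = ⋃ n, stoneCechUnit '' (C ∩ K n) := by
    ext p
    constructor
    · rintro ⟨hpC, hpS⟩
      obtain ⟨n, z, hz, rfl⟩ := mem_iUnion.1 hpS
      exact mem_iUnion.2 ⟨n, z, ⟨hemb.injective (hr _ hpS) ▸ hpC, hz⟩, rfl⟩
    · intro hp
      obtain ⟨n, z, ⟨hzC, hzK⟩, rfl⟩ := mem_iUnion.1 hp
      have hpS : stoneCechUnit z ∈ S := mem_iUnion.2 ⟨n, z, hzK, rfl⟩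
      refine ⟨?_, hpS⟩
      rw [mem_preimage, hemb.injective (hr _ hpS)]
      exact hzC
  have h2 : MeasurableSet (r ⁻¹' C ∩ S) := h1 ▸ .iUnion fun n =>
    (((hK n).inter_left hC).image continuous_stoneCechUnit).isClosed.measurableSet
  have h3 : MeasurableSet (r ⁻¹' C ∩ Sᶜ) := by
    by_cases hz : z₀ ∈ C
    · convert hS.compl using 1
      refine inter_eq_right.2 fun p hp => ?_
      simpa only [r, mem_preimage, if_neg hp] using hz
    · convert MeasurableSet.empty using 1
      refine eq_empty_of_forall_notMem fun p hp => hz ?_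
      simpa only [r, mem_preimage, if_neg hp.2] using hp.1
  rw [← inter_union_compl (r ⁻¹' C) S]
  exact h2.union h3

/-- A tight mean on a Tychonoff space is the integral of a Radon probability measure. -/
theorem IsMean.exists_isRadonProbability [T35Space Z] [MeasurableSpace Z] [BorelSpace Z]
    {I : (Z →ᵇ ℝ) → ℝ} (hI : IsMean I) (ht : IsTightMean I) :
    ∃ γ : Measure Z, IsRadonProbability γ ∧ ∀ f : Z →ᵇ ℝ, ∫ z, f z ∂γ = I f := by
  borelize (StoneCech Z)
  obtain ⟨η, hη, hreg, hint⟩ := hI.exists_measure_stoneCech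
  have hemb : Topology.IsEmbedding (stoneCechUnit : Z → StoneCech Z) := isEmbedding_stoneCechUnit
  -- Tightness bounds the integral of a Urysohn function that is `0` on the image of `K` and `1` off
  -- a neighbourhood `U`. This bounds `η Uᶜ`, and outer regularity shrinks `U` to the image of `K`.
  have hlow : ∀ n : ℕ, ∃ K : Set Z, IsCompact K ∧
      ENNReal.ofReal (1 - 1 / (n + 1)) ≤ η (stoneCechUnit '' K) := fun n => by
    obtain ⟨K, hK, hKI⟩ := ht (1 / (n + 1)) Nat.one_div_pos_of_nat
    refine ⟨K, hK, ?_⟩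
    refine ENNReal.le_of_forall_pos_le_add fun ε hε _ => ?_
    have hιK := hK.image (continuous_stoneCechUnit (α := Z))
    obtain ⟨U, hKU, hU, hUε⟩ := (stoneCechUnit '' K).exists_isOpen_le_add η
      (ENNReal.coe_pos.2 hε).ne'
    refine le_trans ?_ hUε
    obtain ⟨g, hg0, hg1, hg⟩ := exists_continuous_zero_one_of_isClosed hιK.isClosed
      hU.isClosed_compl (disjoint_left.2 fun p hp hp' => hp' (hKU hp))
    have h1 := hKI (restrictStoneCech g) (fun z => (hg _).1) (fun z => (hg _).2)
      (fun z hz => hg0 (mem_image_of_mem _ hz))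
    rw [← hint] at h1
    have h2 : (η Uᶜ).toReal ≤ ∫ p, g p ∂η := by
      have := integral_mono (μ := η) (f := Uᶜ.indicator 1)
        ((integrable_const (1 : ℝ)).indicator hU.isClosed_compl.measurableSet)
        (integrable_boundedContinuous η (mkOfCompact g))
        (fun z => by
          by_cases hz : z ∈ Uᶜ
          · simpa [indicator_of_mem hz] using (hg1 hz).ge
          · simpa [indicator_of_notMem hz] using (hg z).1)
      rwa [integral_indicator_one hU.isClosed_compl.measurableSet] at this
    have h3 : (η Uᶜ).toReal = 1 - (η U).toReal := probReal_compl_eq_one_sub hU.measurableSet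
    rw [ENNReal.ofReal_le_iff_le_toReal (measure_ne_top _ _)]
    linarith
  choose K hK hηK using hlow
  have hS : η (⋃ n, stoneCechUnit '' K n)ᶜ = 0 := by
    rw [prob_compl_eq_zero_iff (.iUnion fun n =>
      ((hK n).image continuous_stoneCechUnit).isClosed.measurableSet)]
    refine le_antisymm prob_le_one ?_
    have hlim : Filter.Tendsto (fun n : ℕ => ENNReal.ofReal (1 - 1 / (n + 1))) Filter.atTop
        (nhds 1) := by
      have := ENNReal.tendsto_ofReal
        ((tendsto_const_nhds (x := (1 : ℝ))).sub tendsto_one_div_add_atTop_nhds_zero_nat)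
      simpa using this
    exact le_of_tendsto' hlim fun n => (hηK n).trans
      (measure_mono (subset_iUnion (fun n => stoneCechUnit '' K n) n))
  -- On an empty space `0 = 1` in `C_b(Z)`, contradicting `I 1 = 1`.
  have hne : Nonempty Z := by
    by_contra h
    have h' : IsEmpty Z := not_nonempty_iff.1 h
    have h0 := hI.map_const 0
    rw [show (0 : ℝ) • (1 : Z →ᵇ ℝ) = 1 by ext z; exact h'.elim z, hI.map_one] at h0
    exact one_ne_zero h0
  obtain ⟨r, hr, hrS⟩ := exists_measurable_retraction hK
  have hae : ∀ᵐ p ∂η, stoneCechUnit (r p) = p := by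
    rw [ae_iff]
    exact measure_mono_null (fun p hp hpS => hp (hrS p hpS)) hS
  have hγ : IsProbabilityMeasure (η.map r) := Measure.isProbabilityMeasure_map hr.aemeasurable
  refine ⟨η.map r, ⟨hγ, fun B hB ε hε => ?_⟩, fun f => ?_⟩
  · have hSm : MeasurableSet (⋃ n, stoneCechUnit '' K n : Set (StoneCech Z)) := .iUnion fun n =>
      ((hK n).image continuous_stoneCechUnit).isClosed.measurableSet
    obtain ⟨L, hLB, hL, hLε⟩ := ((hr hB).inter hSm).exists_isCompact_sdiff_lt
      (measure_ne_top η _) hε.ne'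
    have hLr : ∀ p ∈ L, stoneCechUnit (r p) = p := fun p hp => hrS p (hLB hp).2
    -- On `L` the map `r` inverts the embedding, so the embedded image of `r '' L` is `L` itself.
    have hcompact : IsCompact (r '' L) := by
      rw [hemb.isCompact_iff, image_image, image_congr hLr, image_id']
      exact hL
    refine ⟨r '' L, hcompact, image_subset_iff.2 fun p hp => (hLB hp).1, ?_⟩
    rw [Measure.map_apply hr (hB.diff hcompact.measurableSet)]
    refine (measure_mono_ae ?_).trans_lt hLε
    filter_upwards [measure_eq_zero_iff_ae_notMem.1 hS] with p hpS hp
    exact ⟨⟨hp.1, not_not.1 hpS⟩, fun hpL => hp.2 (mem_image_of_mem r hpL)⟩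
  · rw [integral_map hr.aemeasurable f.continuous.measurable.aestronglyMeasurable]
    obtain ⟨g, hg⟩ := exists_stoneCech_extension f
    have h1 : restrictStoneCech g = f := by ext z; exact hg z
    rw [← h1, ← hint g]
    refine integral_congr_ae ?_
    filter_upwards [hae] with p hp
    rw [h1, ← hg, hp]

end Riesz

/-! ### Integrals of lower semicontinuous functions as suprema. -/

section LowerIntegral

variable {Z : Type u} [TopologicalSpace Z]

/-- Near each point a bump of height `g z - δ/2` (or `0`) supported where `h` is large does the job;
compactness leaves finitely many bumps, and their maximum stays below `h`. -/
theorem exists_boundedContinuous_between_on_compact [T35Space Z] {h : Z → ENNReal}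
    (hh : LowerSemicontinuous h) {g : Z → NNReal} (hg : UpperSemicontinuous g)
    (hgh : ∀ z, (g z : ENNReal) ≤ h z) {K : Set Z} (hK : IsCompact K) {δ : ℝ} (hδ : 0 < δ) :
    ∃ f : Z →ᵇ ℝ, (∀ z, 0 ≤ f z) ∧ (∀ z, ENNReal.ofReal (f z) ≤ h z) ∧
      ∀ z ∈ K, (g z : ℝ) ≤ f z + δ := by
  refine hK.induction_on (p := fun s => ∃ f : Z →ᵇ ℝ, (∀ z, 0 ≤ f z) ∧
    (∀ z, ENNReal.ofReal (f z) ≤ h z) ∧ ∀ z ∈ s, (g z : ℝ) ≤ f z + δ) ?_ ?_ ?_ ?_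
  · exact ⟨0, by simp⟩
  · rintro s t hst ⟨f, hf0, hfh, hf⟩
    exact ⟨f, hf0, hfh, fun z hz => hf z (hst hz)⟩
  · rintro s t ⟨f, hf0, hfh, hf⟩ ⟨f', hf0', hfh', hf'⟩
    refine ⟨f ⊔ f', fun z => (hf0 z).trans (le_sup_left (a := f z)), fun z => ?_, ?_⟩
    · rcases le_total (f z) (f' z) with hz | hz
      · simpa [hz] using hfh' z
      · simpa [hz] using hfh z
    · rintro z (hz | hz)
      · exact (hf z hz).trans (add_le_add_left (le_sup_left (a := f z)) δ)
      · exact (hf' z hz).trans (add_le_add_left (le_sup_right (a := f z)) δ)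
  · intro z _
    suffices H : ∃ f : Z →ᵇ ℝ, (∀ z, 0 ≤ f z) ∧ (∀ z, ENNReal.ofReal (f z) ≤ h z) ∧
        (g z : ℝ) - δ / 2 ≤ f z by
      obtain ⟨f, hf0, hfh, hfz⟩ := H
      refine ⟨{w | (g w : ℝ) ≤ f w + δ}, mem_nhdsWithin_of_mem_nhds ?_, f, hf0, hfh,
        fun w hw => hw⟩
      -- The budget `δ` is spent as `δ/2` at `z`, `δ/4` on the variation of `g` and `δ/4` on that of
      -- `f`.
      have h1 : ∀ᶠ w in nhds z, g w < g z + Real.toNNReal (δ / 4) :=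
        hg z _ (lt_add_of_pos_right _ (Real.toNNReal_pos.2 (by linarith)))
      have h2 : ∀ᶠ w in nhds z, f z - δ / 4 < f w :=
        f.continuous.continuousAt.eventually (lt_mem_nhds (by linarith))
      filter_upwards [h1, h2] with w hw1 hw2
      have hw1' : (g w : ℝ) < g z + δ / 4 := by
        have := NNReal.coe_lt_coe.2 hw1
        rwa [NNReal.coe_add, Real.coe_toNNReal _ (by linarith)] at this
      show (g w : ℝ) ≤ f w + δ
      linarith
    rcases le_or_gt ((g z : ℝ) - δ / 2) 0 with hz | hz
    · exact ⟨0, fun _ => le_rfl, by simp, by simpa using hz⟩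
    · let a : ℝ := (g z : ℝ) - δ / 2
      have hU : IsOpen {w | ENNReal.ofReal a < h w} := hh.isOpen_preimage _
      have hzU : ENNReal.ofReal a < h z := by
        refine lt_of_lt_of_le ?_ (hgh z)
        rw [← ENNReal.ofReal_coe_nnreal]
        exact (ENNReal.ofReal_lt_ofReal_iff (by linarith)).2 (by simp only [a]; linarith)
      obtain ⟨f, hf0, hf1, hfz, hfU⟩ := exists_boundedContinuous_separation
        (isCompact_singleton (x := z)) hU (singleton_subset_iff.2 hzU)
      refine ⟨a • f, fun w => mul_nonneg hz.le (hf0 w), fun w => ?_, ?_⟩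
      · by_cases hw : w ∈ {w | ENNReal.ofReal a < h w}
        · refine le_trans (ENNReal.ofReal_le_ofReal ?_) (le_of_lt hw)
          exact mul_le_of_le_one_right hz.le (hf1 w)
        · simp [hfU w hw]
      · simp [hfz z rfl, a]

variable [MeasurableSpace Z] [BorelSpace Z]

/-- The integral is approached by a bounded simple function `φ ≤ h`, then by an upper semicontinuous
`g ≤ φ`, then by a continuous `f` close to `g` on a large compact set. Each of the losses from `φ`
to `g`, from `g` to `f` on `K`, and off `K` costs `ε/3`. -/
theorem exists_boundedContinuous_lt_integral [T35Space Z] (γ : Measure Z) [IsProbabilityMeasure γ]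
    [γ.InnerRegularCompactLTTop] {h : Z → ENNReal} (hh : LowerSemicontinuous h) {r : ENNReal}
    (hr : r < ∫⁻ z, h z ∂γ) :
    ∃ f : Z →ᵇ ℝ, (∀ z, 0 ≤ f z) ∧ (∀ z, ENNReal.ofReal (f z) ≤ h z) ∧
      r < ENNReal.ofReal (∫ z, f z ∂γ) := by
  rw [lintegral_eq_nnreal] at hr
  simp only [lt_iSup_iff] at hr
  obtain ⟨φ, hφh, hφ⟩ := hr
  rw [← SimpleFunc.lintegral_eq_lintegral] at hφ
  simp only [SimpleFunc.map_apply] at hφ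
  obtain ⟨C, hC⟩ := φ.exists_forall_le
  have hφtop : ∫⁻ z, (φ z : ENNReal) ∂γ ≠ ⊤ := by
    refine ((lintegral_mono fun z => ENNReal.coe_le_coe.2 (hC z)).trans_lt ?_).ne
    simp
  obtain ⟨ε, hε, hrε⟩ : ∃ ε : NNReal, 0 < ε ∧ r + ε < ∫⁻ z, (φ z : ENNReal) ∂γ :=
    ENNReal.lt_iff_exists_add_pos_lt.1 hφ
  have hε3 : (0 : NNReal) < ε / 3 := by positivity
  have hε3' : ((ε / 3 : NNReal) : ENNReal) ≠ 0 := (ENNReal.coe_pos.2 hε3).ne'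
  obtain ⟨g, hgφ, hg, hgint⟩ := φ.exists_upperSemicontinuous_le_lintegral_le hφtop hε3'
  -- If `C = 0` the bound is `∞`, which is harmless: `C * ((ε/3) / C) ≤ ε/3` still holds.
  obtain ⟨K, -, hK, hKC⟩ := MeasurableSet.univ.exists_isCompact_sdiff_lt (measure_ne_top γ univ)
    (ENNReal.div_pos hε3' (ENNReal.coe_ne_top (r := C))).ne'
  rw [← compl_eq_univ_sdiff] at hKC
  obtain ⟨f, hf0, hfh, hfg⟩ := exists_boundedContinuous_between_on_compact hh hg
    (fun z => (ENNReal.coe_le_coe.2 (hgφ z)).trans (hφh z)) hK (NNReal.coe_pos.2 hε3)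
  refine ⟨f, hf0, hfh, ?_⟩
  rw [ofReal_integral_eq_lintegral_ofReal (integrable_boundedContinuous γ f) (.of_forall hf0)]
  have h1 : ∫⁻ z in K, g z ∂γ ≤ (∫⁻ z, ENNReal.ofReal (f z) ∂γ) + (ε / 3 : NNReal) := by
    calc ∫⁻ z in K, (g z : ENNReal) ∂γ
        ≤ ∫⁻ z in K, (ENNReal.ofReal (f z) + (ε / 3 : NNReal)) ∂γ := by
          refine setLIntegral_mono' hK.measurableSet fun z hz => ?_
          rw [← ENNReal.ofReal_coe_nnreal (p := ε / 3), ← ENNReal.ofReal_coe_nnreal (p := g z),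
            ← ENNReal.ofReal_add (hf0 z) (NNReal.coe_nonneg _)]
          exact ENNReal.ofReal_le_ofReal (hfg z hz)
      _ ≤ ∫⁻ z, (ENNReal.ofReal (f z) + (ε / 3 : NNReal)) ∂γ := setLIntegral_le_lintegral _ _
      _ = _ := by
          rw [lintegral_add_right _ measurable_const, lintegral_const, measure_univ, mul_one]
  have h2 : ∫⁻ z in Kᶜ, g z ∂γ ≤ (ε / 3 : NNReal) := by
    calc ∫⁻ z in Kᶜ, (g z : ENNReal) ∂γ ≤ ∫⁻ _ in Kᶜ, (C : ENNReal) ∂γ :=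
          lintegral_mono fun z => ENNReal.coe_le_coe.2 ((hgφ z).trans (hC z))
      _ = C * γ Kᶜ := setLIntegral_const _ _
      _ ≤ C * ((ε / 3 : NNReal) / C) := by gcongr
      _ ≤ (ε / 3 : NNReal) := ENNReal.mul_div_le
  rw [← lintegral_add_compl (fun z => (g z : ENNReal)) hK.measurableSet] at hgint
  have h3 : r + ε < (∫⁻ z, ENNReal.ofReal (f z) ∂γ) + ε := by
    refine hrε.trans_le (hgint.trans ?_)
    refine (add_le_add_left (add_le_add h1 h2) _).trans_eq ?_
    rw [add_assoc, add_assoc, ← ENNReal.coe_add, ← ENNReal.coe_add]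
    congr 2
    ring
  exact lt_of_add_lt_add_right h3

theorem integral_le_toReal_lintegral_ofReal {Z : Type u} [MeasurableSpace Z] {γ : Measure Z}
    {f : Z → ℝ} (hf : Integrable f γ) :
    ∫ z, f z ∂γ ≤ (∫⁻ z, ENNReal.ofReal (f z) ∂γ).toReal := by
  rw [integral_eq_lintegral_pos_part_sub_lintegral_neg_part hf]
  exact sub_le_self _ ENNReal.toReal_nonneg

theorem continuous_add_coe (M : ℝ) : Continuous fun x : EReal => x + M :=
  continuous_iff_continuousAt.2 fun x =>
    (EReal.continuousAt_add (p := (x, (M : EReal))) (.inr (EReal.coe_ne_bot M))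
      (.inr (EReal.coe_ne_top M))).comp (f := fun x : EReal => (x, (M : EReal)))
      (by fun_prop)

/-- Pointwise `(c + M) + c⁻ = c⁺ + M`, and `c⁻ ≤ M` has finite integral, so it may be subtracted.
This reduces matters to nonnegative functions. -/
theorem extIntegral_eq_sub (γ : Measure Z) [IsProbabilityMeasure γ] {c : Z → EReal}
    (hc : LowerSemicontinuous c) {M : ℝ} (hM : 0 ≤ M) (hcM : ∀ z, 0 ≤ c z + M) :
    extIntegral γ c = ((∫⁻ z, (c z + M).toENNReal ∂γ : ENNReal) : EReal) - M := by
  have hmeas : Measurable c := hc.measurable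
  have hpt : ∀ z, (c z + M).toENNReal + (-c z).toENNReal =
      (c z).toENNReal + ENNReal.ofReal M := fun z => by
    have := hcM z
    induction h : c z with
    | bot => simp [h] at this
    | top => simp
    | coe x =>
      rw [h, ← EReal.coe_add] at this
      have hx : 0 ≤ x + M := EReal.coe_nonneg.1 this
      rw [← EReal.coe_add, ← EReal.coe_neg]
      simp only [EReal.real_coe_toENNReal]
      rcases le_total 0 x with h0 | h0
      · rw [ENNReal.ofReal_of_nonpos (p := -x) (by linarith), add_zero, ENNReal.ofReal_add h0 hM]
      · rw [ENNReal.ofReal_of_nonpos h0, zero_add, ← ENNReal.ofReal_add hx (by linarith)]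
        congr 1
        ring
  have hle : ∀ z, (-c z).toENNReal ≤ ENNReal.ofReal M := fun z => by
    rw [← EReal.real_coe_toENNReal]
    refine EReal.toENNReal_le_toENNReal ?_
    have := hcM z
    induction h : c z with
    | bot => simp [h] at this
    | top => simp
    | coe x =>
      rw [h, ← EReal.coe_add] at this
      have hx : 0 ≤ x + M := EReal.coe_nonneg.1 this
      rw [← EReal.coe_neg]
      exact EReal.coe_le_coe_iff.2 (by linarith)
  have hneg : Measurable fun z => (-c z).toENNReal :=
    EReal.continuous_toENNReal.measurable.comp hmeas.neg
  have hint := lintegral_congr (μ := γ) hpt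
  rw [lintegral_add_right _ hneg,
    lintegral_add_right _ measurable_const, lintegral_const, measure_univ, mul_one] at hint
  have hN : ∫⁻ z, (-c z).toENNReal ∂γ ≠ ⊤ := by
    refine ((lintegral_mono hle).trans_lt ?_).ne
    simp
  unfold extIntegral
  generalize (∫⁻ z, (-c z).toENNReal ∂γ) = N at *
  generalize (∫⁻ z, (c z).toENNReal ∂γ) = P at *
  generalize (∫⁻ z, (c z + M).toENNReal ∂γ) = H at *
  lift N to NNReal using hN
  by_cases hP : P = ⊤
  · have hH : H = ⊤ := by
      rw [hP, top_add] at hint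
      simpa using hint
    rw [hP, hH]
    rfl
  · have hH : H ≠ ⊤ := by
      rintro rfl
      rw [top_add] at hint
      exact ENNReal.add_ne_top.2 ⟨hP, ENNReal.ofReal_ne_top⟩ hint.symm
    lift P to NNReal using hP
    lift H to NNReal using hH
    have h := congrArg ENNReal.toReal hint
    rw [ENNReal.toReal_add (by simp) (by simp), ENNReal.toReal_add (by simp) (by simp),
      ENNReal.toReal_ofReal hM] at h
    simp only [ENNReal.coe_toReal] at h
    show ((P : ℝ) : EReal) - ((N : ℝ) : EReal) = ((H : ℝ) : EReal) - M
    rw [← EReal.coe_sub, ← EReal.coe_sub]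
    congr 1
    linarith

/-- For a Radon probability measure and a lower semicontinuous function bounded from below, the
usual integral is the supremum of the integrals of the smaller bounded continuous functions. -/
theorem iSup_integral_eq_extIntegral [T35Space Z] (γ : Measure Z) [IsProbabilityMeasure γ]
    [γ.InnerRegularCompactLTTop] {c : Z → EReal} (hc : c ∈ lscBoundedBelow Z) :
    ⨆ (f : Z →ᵇ ℝ) (_ : ∀ z, ((f z : ℝ) : EReal) ≤ c z), ((∫ z, f z ∂γ : ℝ) : EReal) =
      extIntegral γ c := by
  obtain ⟨hlsc, ⟨b, hb⟩, -⟩ := hc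
  let M : ℝ := max (-b) 0
  have hbM : 0 ≤ b + M := by linarith [le_max_left (-b) 0]
  have hcM : ∀ z, 0 ≤ c z + M := fun z => by
    calc (0 : EReal) ≤ ((b + M : ℝ) : EReal) := EReal.coe_nonneg.2 hbM
      _ = (b : EReal) + M := EReal.coe_add _ _
      _ ≤ c z + M := add_le_add_left (hb z) _
  rw [extIntegral_eq_sub γ hlsc (le_max_right _ _) hcM]
  have hint : ∀ (f : Z →ᵇ ℝ) (t : ℝ), ∫ z, (f + t • (1 : Z →ᵇ ℝ)) z ∂γ = (∫ z, f z ∂γ) + t :=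
    fun f t => by
      have hI := isMean_integral γ
      exact (hI.map_add _ _).trans (congrArg _ (hI.map_const t))
  have hMbot := EReal.coe_ne_bot M
  have hMtop := EReal.coe_ne_top M
  apply le_antisymm
  · refine iSup₂_le fun f hf => ?_
    rw [EReal.le_sub_iff_add_le (.inl hMbot) (.inl hMtop), ← EReal.coe_add, ← hint]
    refine le_trans (EReal.coe_le_coe_iff.2
      (integral_le_toReal_lintegral_ofReal (integrable_boundedContinuous γ _))) ?_
    have hle : ∫⁻ z, ENNReal.ofReal ((f + M • (1 : Z →ᵇ ℝ)) z) ∂γ ≤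
        ∫⁻ z, (c z + M).toENNReal ∂γ := lintegral_mono fun z => by
      rw [← EReal.real_coe_toENNReal]
      refine EReal.toENNReal_le_toENNReal ?_
      have : (f + M • (1 : Z →ᵇ ℝ)) z = f z + M := by simp
      rw [this, EReal.coe_add]
      exact add_le_add_left (hf z) _
    rw [EReal.coe_ennreal_toReal]
    · exact EReal.coe_ennreal_le_coe_ennreal_iff.2 hle
    · exact (integrable_boundedContinuous γ (f + M • (1 : Z →ᵇ ℝ))).lintegral_lt_top.ne
  · rw [EReal.sub_le_iff_le_add (.inl hMbot) (.inl hMtop)]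
    set S := ⨆ (f : Z →ᵇ ℝ) (_ : ∀ z, ((f z : ℝ) : EReal) ≤ c z), ((∫ z, f z ∂γ : ℝ) : EReal)
      with hS
    -- A function below `c + M` becomes a competitor for `S` after subtracting `M`.
    have hSge : ∀ f : Z →ᵇ ℝ, (∀ z, ENNReal.ofReal (f z) ≤ (c z + M).toENNReal) →
        ((∫ z, f z ∂γ : ℝ) : EReal) ≤ S + M := fun f hf => by
      have h1 : ∀ z, (((f + (-M) • (1 : Z →ᵇ ℝ)) z : ℝ) : EReal) ≤ c z := fun z => by
        have : (f + (-M) • (1 : Z →ᵇ ℝ)) z = f z - M := by simp [sub_eq_add_neg]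
        rw [this, EReal.coe_sub, EReal.sub_le_iff_le_add (.inl hMbot) (.inl hMtop),
          ← EReal.coe_toENNReal (hcM z)]
        refine le_trans ?_ (EReal.coe_ennreal_le_coe_ennreal_iff.2 (hf z))
        rw [EReal.coe_ennreal_ofReal]
        exact EReal.coe_le_coe_iff.2 (le_max_left _ _)
      have h2 : ((∫ z, (f + (-M) • (1 : Z →ᵇ ℝ)) z ∂γ : ℝ) : EReal) ≤ S :=
        le_iSup₂_of_le (f + (-M) • (1 : Z →ᵇ ℝ)) h1 le_rfl
      rw [hint, ← sub_eq_add_neg, EReal.coe_sub,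
        EReal.sub_le_iff_le_add (.inl hMbot) (.inl hMtop)] at h2
      exact h2
    -- Nonnegativity, from the competitor `f = 0`, lets the comparison move to `ENNReal`.
    have hS0 : 0 ≤ S + M := by simpa using hSge 0 (by simp)
    by_contra! hlt
    rw [← EReal.coe_toENNReal hS0, EReal.coe_ennreal_lt_coe_ennreal_iff] at hlt
    obtain ⟨f, hf0, hfc, hf⟩ := exists_boundedContinuous_lt_integral γ
      ((EReal.continuous_toENNReal.comp (continuous_add_coe M)).comp_lowerSemicontinuous hlsc
        fun x y hxy => EReal.toENNReal_le_toENNReal (add_le_add_left hxy _)) hlt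
    have h3 := hSge f hfc
    rw [← EReal.real_coe_toENNReal] at hf
    exact absurd (EReal.toENNReal_le_toENNReal h3) (not_le.2 hf)

end LowerIntegral

/-! ### Functionals with given marginals, and the transport problem. -/

section Plans

theorem IsRadonProbability.map_eq_of_integral_eq {Z : Type u} {X : Type v} [TopologicalSpace Z]
    [MeasurableSpace Z] [BorelSpace Z] [TopologicalSpace X] [T35Space X] [MeasurableSpace X]
    [BorelSpace X] {γ : Measure Z} {μ : Measure X} (hγ : IsRadonProbability γ)
    (hμ : IsRadonProbability μ) {p : Z → X} (hp : Continuous p)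
    (h : ∀ φ : X →ᵇ ℝ, ∫ z, φ (p z) ∂γ = ∫ x, φ x ∂μ) : γ.map p = μ := by
  have := hγ.1
  have := hμ.1
  have := hγ.innerRegularCompactLTTop
  have := hμ.innerRegularCompactLTTop
  have := Measure.InnerRegularCompactLTTop.map_of_continuous (μ := γ) hp
  have := Measure.isProbabilityMeasure_map (μ := γ) hp.measurable.aemeasurable
  refine measure_ext_of_integral_eq fun φ => ?_
  rw [integral_map hp.measurable.aemeasurable φ.continuous.measurable.aestronglyMeasurable, h]

theorem IsRadonProbability.exists_isCompact_integral_le {X : Type u} [TopologicalSpace X]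
    [T2Space X] [MeasurableSpace X] [BorelSpace X] {μ : Measure X} (hμ : IsRadonProbability μ)
    {ε : ℝ} (hε : 0 < ε) : ∃ K : Set X, IsCompact K ∧ ∀ φ : X →ᵇ ℝ, (∀ x, φ x ≤ 1) →
      (∀ x ∈ K, φ x = 0) → ∫ x, φ x ∂μ ≤ ε := by
  have := hμ.1
  obtain ⟨K, hK, -, hKε⟩ := hμ.2 univ .univ (ENNReal.ofReal ε) (ENNReal.ofReal_pos.2 hε)
  rw [← compl_eq_univ_sdiff] at hKε
  refine ⟨K, hK, fun φ h1 h0 => ?_⟩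
  have hKm := hK.measurableSet.compl
  have := integral_mono (μ := μ) (g := Kᶜ.indicator 1) (integrable_boundedContinuous μ φ)
    ((integrable_const (1 : ℝ)).indicator hKm) (fun x => by
      by_cases hx : x ∈ K
      · simp [hx, h0 x hx]
      · simp [hx, h1 x])
  rw [integral_indicator_one hKm] at this
  exact this.trans ((ENNReal.lt_ofReal_iff_toReal_lt (measure_ne_top _ _)).1 hKε).le

variable {X : Type u} {Y : Type v} [TopologicalSpace X] [TopologicalSpace Y]
  [MeasurableSpace X] [MeasurableSpace Y]

/-- The means on `C_b(X × Y)` with marginals `μ` and `ν`. -/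
def marginalMeans (μ : Measure X) (ν : Measure Y) : Set (((X × Y) →ᵇ ℝ) → ℝ) :=
  {I | IsMean I ∧ ∀ (φ : X →ᵇ ℝ) (ψ : Y →ᵇ ℝ),
    I (oplus φ ψ) = (∫ x, φ x ∂μ) + ∫ y, ψ y ∂ν}

/-- The set lies in the product of the intervals `[-‖f‖, ‖f‖]`, compact by Tychonoff, and each
defining condition involves finitely many coordinates, hence is closed. Loss of mass in the limit is
no concern here, since Radon marginals restore tightness. -/
theorem isCompact_marginalMeans (μ : Measure X) (ν : Measure Y) :
    IsCompact (marginalMeans μ ν) := by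
  have hpi : IsCompact (univ.pi fun f : (X × Y) →ᵇ ℝ => Icc (-‖f‖) ‖f‖) :=
    isCompact_univ_pi fun f => isCompact_Icc
  refine hpi.of_isClosed_subset ?_ fun I hI f _ => abs_le.1 (hI.1.abs_le_norm f)
  have h : marginalMeans μ ν =
      {I | ∀ f g, I (f + g) = I f + I g} ∩ {I | ∀ (t : ℝ) f, I (t • f) = t * I f} ∩
      {I | ∀ f : (X × Y) →ᵇ ℝ, (∀ z, 0 ≤ f z) → 0 ≤ I f} ∩ {I | I 1 = 1} ∩
      {I | ∀ (φ : X →ᵇ ℝ) (ψ : Y →ᵇ ℝ), I (oplus φ ψ) = (∫ x, φ x ∂μ) + ∫ y, ψ y ∂ν} := by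
    ext I
    exact ⟨fun ⟨⟨h1, h2, h3, h4⟩, h5⟩ => ⟨⟨⟨⟨h1, h2⟩, h3⟩, h4⟩, h5⟩,
      fun ⟨⟨⟨⟨h1, h2⟩, h3⟩, h4⟩, h5⟩ => ⟨⟨h1, h2, h3, h4⟩, h5⟩⟩
  rw [h]
  refine (((IsClosed.inter ?_ ?_).inter ?_).inter ?_).inter ?_
  · simp only [ofPred_forall]
    exact isClosed_iInter fun f => isClosed_iInter fun g => isClosed_eq (by fun_prop) (by fun_prop)
  · simp only [ofPred_forall]
    exact isClosed_iInter fun f => isClosed_iInter fun g => isClosed_eq (by fun_prop) (by fun_prop)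
  · simp only [ofPred_forall]
    exact isClosed_iInter fun f => isClosed_iInter fun _ =>
      isClosed_le (by fun_prop) (by fun_prop)
  · exact isClosed_eq (by fun_prop) (by fun_prop)
  · simp only [ofPred_forall]
    exact isClosed_iInter fun f => isClosed_iInter fun g => isClosed_eq (by fun_prop) (by fun_prop)

/-- By the tube lemma `f < ε/2` on some `U × V ⊇ K × L`. Off it `1 - φ` or `1 - ψ` equals `1`, so `f
≤ ε/2 + (1 - φ) ⊕ (1 - ψ)`; the marginals bound the last term by `ε/4 + ε/4`. -/
theorem isTightMean_of_mem_marginalMeans [T35Space X] [T35Space Y] [BorelSpace X] [BorelSpace Y]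
    {μ : Measure X} {ν : Measure Y} (hμ : IsRadonProbability μ) (hν : IsRadonProbability ν)
    {I : ((X × Y) →ᵇ ℝ) → ℝ} (hI : I ∈ marginalMeans μ ν) : IsTightMean I := by
  intro ε hε
  obtain ⟨K, hK, hKμ⟩ := hμ.exists_isCompact_integral_le (show 0 < ε / 4 by linarith)
  obtain ⟨L, hL, hLν⟩ := hν.exists_isCompact_integral_le (show 0 < ε / 4 by linarith)
  refine ⟨K ×ˢ L, hK.prod hL, fun f hf0 hf1 hf => ?_⟩
  have hopen : IsOpen {z | f z < ε / 2} := isOpen_lt f.continuous continuous_const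
  obtain ⟨U, V, hU, hV, hKU, hLV, hUV⟩ := generalized_tube_lemma hK hL hopen fun z hz => by
    show f z < ε / 2
    rw [hf z hz]
    linarith
  obtain ⟨φ, hφ0, hφ1, hφK, hφU⟩ := exists_boundedContinuous_separation hK hU hKU
  obtain ⟨ψ, hψ0, hψ1, hψL, hψV⟩ := exists_boundedContinuous_separation hL hV hLV
  let G : (X × Y) →ᵇ ℝ := (ε / 2) • (1 : (X × Y) →ᵇ ℝ) + oplus (1 - φ) (1 - ψ)
  have hle : I f ≤ I G := hI.1.mono fun z => by
    have hz : G z = ε / 2 + ((1 - φ z.1) + (1 - ψ z.2)) := by simp [G, oplus]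
    rw [hz]
    have h1 := hφ1 z.1
    have h2 := hψ1 z.2
    by_cases hzU : z.1 ∈ U
    · by_cases hzV : z.2 ∈ V
      · have : f z < ε / 2 := hUV (mk_mem_prod hzU hzV)
        linarith
      · linarith [hf1 z, hψV z.2 hzV]
    · linarith [hf1 z, hφU z.1 hzU]
  rw [hI.1.map_add, hI.1.map_const, hI.2] at hle
  have h1 := hKμ (1 - φ) (fun x => by simpa using hφ0 x) (fun x hx => by simp [hφK x hx])
  have h2 := hLν (1 - ψ) (fun y => by simpa using hψ0 y) (fun y hy => by simp [hψL y hy])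
  linarith

/-- The functional on `C_b(Z)` given by integration against a Borel measure. -/
noncomputable def borelIntegral {Z : Type u} [TopologicalSpace Z] (γ : BorelMeasure Z)
    (f : Z →ᵇ ℝ) : ℝ :=
  @integral Z ℝ _ _ (borel Z) γ f

theorem borelIntegral_mem_marginalMeans [BorelSpace X] [BorelSpace Y] {μ : Measure X}
    {ν : Measure Y} {γ : BorelMeasure (X × Y)} (hγ : γ ∈ transportPlans μ ν) :
    borelIntegral γ ∈ marginalMeans μ ν := by
  let _ : MeasurableSpace (X × Y) := borel (X × Y)
  have : BorelSpace (X × Y) := ⟨rfl⟩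
  obtain ⟨hγ, rfl, rfl⟩ := hγ
  have := hγ.1
  have hI : IsMean (borelIntegral γ) := isMean_integral γ
  refine ⟨hI, fun φ ψ => ?_⟩
  rw [oplus, hI.map_add]
  congr 1
  · exact (integral_map continuous_fst.measurable.aemeasurable
      φ.continuous.measurable.aestronglyMeasurable).symm
  · exact (integral_map continuous_snd.measurable.aemeasurable
      ψ.continuous.measurable.aestronglyMeasurable).symm

theorem exists_transportPlan_of_mem_marginalMeans [T35Space X] [T35Space Y] [BorelSpace X]
    [BorelSpace Y] {μ : Measure X} {ν : Measure Y} (hμ : IsRadonProbability μ)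
    (hν : IsRadonProbability ν) {I : ((X × Y) →ᵇ ℝ) → ℝ} (hI : I ∈ marginalMeans μ ν) :
    ∃ γ ∈ transportPlans μ ν, borelIntegral γ = I := by
  let _ : MeasurableSpace (X × Y) := borel (X × Y)
  have : BorelSpace (X × Y) := ⟨rfl⟩
  obtain ⟨γ, hγ, hγI⟩ := hI.1.exists_isRadonProbability (isTightMean_of_mem_marginalMeans hμ hν hI)
  refine ⟨γ, ⟨hγ, ?_, ?_⟩, funext hγI⟩
  · refine hγ.map_eq_of_integral_eq hμ continuous_fst fun φ => ?_
    -- Testing with `φ ⊕ 0` isolates the first marginal; `0 ⊕ ψ` does the same for the second.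
    have h := hI.2 φ 0
    rw [← hγI] at h
    simpa [oplus] using h
  · refine hγ.map_eq_of_integral_eq hν continuous_snd fun ψ => ?_
    have h := hI.2 0 ψ
    rw [← hγI] at h
    simpa [oplus] using h

theorem toCharge_mem_unitCharges {Z : Type u} [TopologicalSpace Z] {γ : BorelMeasure Z}
    (hγ : @IsRadonProbability Z _ (borel Z) γ) : toCharge γ ∈ unitCharges Z :=
  let _ : MeasurableSpace Z := borel Z
  have : BorelSpace Z := ⟨rfl⟩
  have := hγ.1
  measureCharge_mem_unitCharges γ

theorem chargeIntegral_toCharge {Z : Type u} [TopologicalSpace Z] {γ : BorelMeasure Z}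
    (hγ : @IsRadonProbability Z _ (borel Z) γ) :
    chargeIntegral (toCharge γ) = borelIntegral γ :=
  let _ : MeasurableSpace Z := borel Z
  have : BorelSpace Z := ⟨rfl⟩
  have := hγ.1
  funext (chargeIntegral_measureCharge γ)

/-- Equal charges have equal integrals, hence come from equal Radon measures. Conversely, the plan
representing the functional of a charge restricts to a charge with the same integrals, hence to the
given one. -/
theorem bijOn_toCharge [T35Space X] [T35Space Y] [BorelSpace X] [BorelSpace Y] {μ : Measure X}
    {ν : Measure Y} (hμ : IsRadonProbability μ) (hν : IsRadonProbability ν) :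
    BijOn toCharge (transportPlans μ ν) (chargePlans μ ν) := by
  refine ⟨fun γ hγ => ⟨toCharge_mem_unitCharges hγ.1, ?_⟩, fun γ hγ η hη h => ?_, fun m hm => ?_⟩
  · rw [chargeIntegral_toCharge hγ.1]
    exact (borelIntegral_mem_marginalMeans hγ).2
  · let _ : MeasurableSpace (X × Y) := borel (X × Y)
    have : BorelSpace (X × Y) := ⟨rfl⟩
    have := hγ.1.1
    have := hη.1.1
    have := hγ.1.innerRegularCompactLTTop
    have := hη.1.innerRegularCompactLTTop
    refine measure_ext_of_integral_eq fun f => ?_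
    have h' := congrArg chargeIntegral h
    rw [chargeIntegral_toCharge hγ.1, chargeIntegral_toCharge hη.1] at h'
    exact congrFun h' f
  · obtain ⟨γ, hγ, hγm⟩ := exists_transportPlan_of_mem_marginalMeans hμ hν
      (I := chargeIntegral m) ⟨isMean_chargeIntegral hm.1, hm.2⟩
    refine ⟨γ, hγ, unitCharges_ext (toCharge_mem_unitCharges hγ.1) hm.1 fun f => ?_⟩
    rw [chargeIntegral_toCharge hγ.1, hγm]

/-- The cost depends on the plan only through its functional, which makes the direct method
available on functionals. -/
theorem planCost_eq_iSup [T35Space X] [T35Space Y] {μ : Measure X} {ν : Measure Y}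
    {c : X × Y → EReal} (hc : c ∈ lscBoundedBelow (X × Y)) {γ : BorelMeasure (X × Y)}
    (hγ : γ ∈ transportPlans μ ν) :
    planCost c γ = ⨆ (f : (X × Y) →ᵇ ℝ) (_ : ∀ z, ((f z : ℝ) : EReal) ≤ c z),
      ((borelIntegral γ f : ℝ) : EReal) := by
  let _ : MeasurableSpace (X × Y) := borel (X × Y)
  have : BorelSpace (X × Y) := ⟨rfl⟩
  have := hγ.1.1
  have := hγ.1.innerRegularCompactLTTop
  exact (iSup_integral_eq_extIntegral γ hc).symm

theorem chargeLowerIntegral_toCharge [T35Space X] [T35Space Y] {μ : Measure X} {ν : Measure Y}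
    {c : X × Y → EReal} (hc : c ∈ lscBoundedBelow (X × Y)) {γ : BorelMeasure (X × Y)}
    (hγ : γ ∈ transportPlans μ ν) : chargeLowerIntegral (toCharge γ) c = planCost c γ := by
  rw [planCost_eq_iSup hc hγ, chargeLowerIntegral, chargeIntegral_toCharge hγ.1]

theorem exists_planCost_eq_valueKP [T35Space X] [T35Space Y] [BorelSpace X] [BorelSpace Y]
    {μ : Measure X} {ν : Measure Y} (hμ : IsRadonProbability μ) (hν : IsRadonProbability ν)
    {c : X × Y → EReal} (hc : c ∈ lscBoundedBelow (X × Y)) (hv : valueKP μ ν c < ⊤) :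
    ∃ γ ∈ transportPlans μ ν, planCost c γ = valueKP μ ν c := by
  -- An infimum over no plans would be `⊤`, so finiteness of the value supplies a plan.
  have hne : (marginalMeans μ ν).Nonempty := by
    simp only [valueKP, iInf_lt_iff] at hv
    obtain ⟨γ, hγ, -⟩ := hv
    exact ⟨_, borelIntegral_mem_marginalMeans hγ⟩
  -- Each evaluation is continuous for pointwise convergence, and suprema preserve lower
  -- semicontinuity.
  have hlsc : LowerSemicontinuous fun I : ((X × Y) →ᵇ ℝ) → ℝ =>
      ⨆ (f : (X × Y) →ᵇ ℝ) (_ : ∀ z, ((f z : ℝ) : EReal) ≤ c z), ((I f : ℝ) : EReal) :=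
    lowerSemicontinuous_biSup fun f _ =>
      (continuous_coe_real_ereal.comp (continuous_apply f)).lowerSemicontinuous
  obtain ⟨I, hI, hmin⟩ := (hlsc.lowerSemicontinuousOn _).exists_isMinOn hne
    (isCompact_marginalMeans μ ν)
  obtain ⟨γ, hγ, rfl⟩ := exists_transportPlan_of_mem_marginalMeans hμ hν hI
  refine ⟨γ, hγ, le_antisymm (le_iInf₂ fun η hη => ?_) (iInf₂_le γ hγ)⟩
  rw [planCost_eq_iSup hc hγ, planCost_eq_iSup hc hη]
  exact hmin (borelIntegral_mem_marginalMeans hη)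

end Plans

end KantorovichCharge

open MeasureTheory KantorovichCharge in
theorem mainTheorem5 {X : Type*} {Y : Type*}
    [TopologicalSpace X] [T2Space X] [PerfectlyNormalSpace X] [MeasurableSpace X] [BorelSpace X]
    [TopologicalSpace Y] [T2Space Y] [PerfectlyNormalSpace Y] [MeasurableSpace Y] [BorelSpace Y]
    (μ : Measure X) (ν : Measure Y) (hμ : IsRadonProbability μ) (hν : IsRadonProbability ν) :
    Set.BijOn toCharge (transportPlans μ ν) (chargePlans μ ν) ∧
    ∀ c ∈ lscBoundedBelow (X × Y),
      (∀ γ ∈ transportPlans μ ν, chargeLowerIntegral (toCharge γ) c = planCost c γ) ∧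
      valueOP μ ν c = valueKP μ ν c ∧
      (valueKP μ ν c < ⊤ → ∃ γ ∈ transportPlans μ ν, planCost c γ = valueKP μ ν c) := by
  -- Perfectly normal Hausdorff spaces are Tychonoff, a property that passes to the product.
  have hbij := bijOn_toCharge hμ hν
  refine ⟨hbij, fun c hc => ⟨fun γ hγ => chargeLowerIntegral_toCharge hc hγ, ?_,
    exists_planCost_eq_valueKP hμ hν hc⟩⟩
  rw [valueOP, ← hbij.image_eq, iInf_image]
  exact iInf_congr fun γ => iInf_congr fun hγ => chargeLowerIntegral_toCharge hc hγ
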